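/- Let $A\subset\mathbb R^{m_a}$ and $B\subset\mathbb R^{m_b}$ be nonempty compact sets, let $T\ge 0$, and let $f:\mathbb R^n\times A\times B\to\mathbb R^n$, $L:\mathbb R^n\times A\times B\to\mathbb R$, $g,c:\mathbb R^n\to\mathbb R$ be time-invariant dynamics, stage cost, terminal cost and state constraint. Assume: $f$ and $L$ are Lipschitz continuous in $x$, with constants independent of $(a,b)\in A\times B$, and Borel measurable in $(a,b)$ for each $x$; for every $x$ the sets $\{f(x,a,b): a\in A,b\in B\}$ and $\{L(x,a,b): a\in A,b\in B\}$ are compact and convex; $g$ and $c$ are Lipschitz continuous; $L$ and $g$ are bounded below. For $t\in[0,T]$ let $\mathcal A(t)$, $\mathcal B(t)$, $\mathcal M(t)$ be the sets of measurable, essentially bounded functions on $[t,T]$ with values in $A$, $B$ and $[0,1]$, respectively. A map $\Phi$ from (pairs of) such signals to such signals is called non-anticipative if for every $s\in[t,T]$, whenever two inputs agree a.e. on $[t,s]$, their images under $\Phi$ agree a.e. on $[t,s]$. Let $\Delta(t)$, $\Gamma(t)$, $\mathrm N_B(t)$, $\tilde\Delta(t)$ be the sets of non-anticipative maps $\mathcal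 A(t)\to\mathcal B(t)$, $\mathcal B(t)\to\mathcal A(t)$, $\mathcal B(t)\to\mathcal M(t)$ and $\mathcal A(t)\times\mathcal M(t)\to\mathcal B(t)$, respectively. For $x\in\mathbb R^n$, $z\in\mathbb R$, $\alpha\in\mathcal A(t)$, $\beta\in\mathcal B(t)$ let $$J_2(t,x,z,\alpha,\beta)=\min_{\tau\in[t,T]}\max\Big\{\max_{s\in[t,\tau]}c(\mathrm x(s)),\ \int_t^\tau L(\mathrm x(s),\alpha(s),\beta(s))\,ds+g(\mathrm x(\tau))-z\Big\},$$ where $\dot{\mathrm x}(s)=f(\mathrm x(s),\alpha(s),\beta(s))$ for a.e. $s\in[t,T]$, $\mathrm x(t)=x$, and let $$V_2^+(t,x,z)=\sup_{\delta\in\Delta(t)}\inf_{\alpha\in\mathcal A(t)}J_2(t,x,z,\alpha,\delta[\alpha]),\qquad V_2^-(t,x,z)=\inf_{\gamma\in\Gamma(t)}\sup_{\beta\in\mathcal B(t)}J_2(t,x,z,\gamma[\beta],\beta).$$ For $\mu\in\mathcal M(t)$ let $$\tilde J(t,x,z,\alpha,\beta,\mu)=\max\Big\{\max_{s\in[t,T]}c(\mathrm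 x(s)),\ g(\mathrm x(T))-\mathrm z(T)\Big\},$$ where $\dot{\mathrm x}(s)=f(\mathrm x(s),\alpha(s),\beta(s))\,\mu(s)$, $\dot{\mathrm z}(s)=-L(\mathrm x(s),\alpha(s),\beta(s))\,\mu(s)$ for a.e. $s\in[t,T]$, $\mathrm x(t)=x$, $\mathrm z(t)=z$. Then for all $(t,x,z)\in[0,T]\times\mathbb R^n\times\mathbb R$, $$V_2^+(t,x,z)=\sup_{\tilde\delta\in\tilde\Delta(t)}\ \inf_{\alpha\in\mathcal A(t),\,\mu\in\mathcal M(t)}\tilde J(t,x,z,\alpha,\tilde\delta[\alpha,\mu],\mu),$$ $$V_2^-(t,x,z)=\inf_{\gamma\in\Gamma(t),\,\nu_B\in\mathrm N_B(t)}\ \sup_{\beta\in\mathcal B(t)}\tilde J(t,x,z,\gamma[\beta],\beta,\nu_B[\beta]).$$ -/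

import Mathlib

open MeasureTheory Set
open scoped NNReal

noncomputable section

/-- Measurable, essentially bounded control signals on `[t, T]` with values in `U`.
A signal is represented by a function on `ℝ`; its values outside `[t, T]` are never used. -/
def ControlSignal {E : Type*} [NormedAddCommGroup E] (U : Set E) (t T : ℝ) : Type _ :=
  {u : ℝ → E // MemLp u ⊤ (volume.restrict (Icc t T)) ∧ ∀ s ∈ Icc t T, u s ∈ U}

/-- Two functions of time agree almost everywhere on `[t, s]`. -/
def AgreeOn {E : Type*} (t s : ℝ) (u v : ℝ → E) : Prop :=
  ∀ᵐ r ∂(volume.restrict (Icc t s)), u r = v r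

/-- Non-anticipative strategies reacting to one signal. -/
def Strategy {E F : Type*} [NormedAddCommGroup E] [NormedAddCommGroup F]
    (U : Set E) (W : Set F) (t T : ℝ) : Type _ :=
  {δ : ControlSignal U t T → ControlSignal W t T //
    ∀ s ∈ Icc t T, ∀ u u' : ControlSignal U t T,
      AgreeOn t s u.1 u'.1 → AgreeOn t s (δ u).1 (δ u').1}

/-- Non-anticipative strategies reacting to a pair of signals. -/
def PairStrategy {E E' F : Type*} [NormedAddCommGroup E] [NormedAddCommGroup E']
    [NormedAddCommGroup F] (U : Set E) (U' : Set E') (W : Set F) (t T : ℝ) : Type _ :=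
  {δ : ControlSignal U t T → ControlSignal U' t T → ControlSignal W t T //
    ∀ s ∈ Icc t T, ∀ (u v : ControlSignal U t T) (u' v' : ControlSignal U' t T),
      AgreeOn t s u.1 v.1 → AgreeOn t s u'.1 v'.1 → AgreeOn t s (δ u u').1 (δ v v').1}

/-- The freezing controls `μ : [t, T] → [0, 1]` take their values in this set. -/
def freezeSet : Set ℝ := Icc 0 1

/-- `y` is a (Carathéodory) solution on `[t, T]` of `y' = F(s, y)`, `y(t) = y₀`. -/
def IsTrajectory {X : Type*} [NormedAddCommGroup X] [NormedSpace ℝ X]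
    (F : ℝ → X → X) (t T : ℝ) (y₀ : X) (y : ℝ → X) : Prop :=
  ContinuousOn y (Icc t T) ∧
  IntervalIntegrable (fun s => F s (y s)) volume t T ∧
  ∀ s ∈ Icc t T, y s = y₀ + ∫ r in t..s, F r (y r)

/-- The solution of `y' = F(s, y)`, `y(t) = y₀` on `[t, T]` (unique there for the Lipschitz
right-hand sides to which it is applied; only its values on `[t, T]` are used). -/
def trajectory {X : Type*} [NormedAddCommGroup X] [NormedSpace ℝ X]
    (F : ℝ → X → X) (t T : ℝ) (y₀ : X) : ℝ → X :=
  Classical.epsilon (IsTrajectory F t T y₀)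

section Game

variable {n ma mb : ℕ}

/-- The state trajectory of `x' = f(s, x, α, β)`, `x(t) = x₀`. -/
def stateTraj
    (f : ℝ → EuclideanSpace ℝ (Fin n) → EuclideanSpace ℝ (Fin ma) → EuclideanSpace ℝ (Fin mb) →
      EuclideanSpace ℝ (Fin n))
    (t T : ℝ) (x₀ : EuclideanSpace ℝ (Fin n))
    (α : ℝ → EuclideanSpace ℝ (Fin ma)) (β : ℝ → EuclideanSpace ℝ (Fin mb)) :
    ℝ → EuclideanSpace ℝ (Fin n) :=
  trajectory (fun s x => f s x (α s) (β s)) t T x₀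

/-- The free-terminal-time cost
`J₂ = min_{τ ∈ [t,T]} max { max_{s ∈ [t,τ]} c(s, x(s)), ∫_t^τ L ds + g(τ, x(τ)) - z }`.
Extrema are taken in the extended reals, where they always exist. -/
def costJ2
    (f : ℝ → EuclideanSpace ℝ (Fin n) → EuclideanSpace ℝ (Fin ma) → EuclideanSpace ℝ (Fin mb) →
      EuclideanSpace ℝ (Fin n))
    (L : ℝ → EuclideanSpace ℝ (Fin n) → EuclideanSpace ℝ (Fin ma) → EuclideanSpace ℝ (Fin mb) → ℝ)
    (g c : ℝ → EuclideanSpace ℝ (Fin n) → ℝ)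
    (t T : ℝ) (x₀ : EuclideanSpace ℝ (Fin n)) (z : ℝ)
    (α : ℝ → EuclideanSpace ℝ (Fin ma)) (β : ℝ → EuclideanSpace ℝ (Fin mb)) : EReal :=
  ⨅ τ ∈ Icc t T,
    max (⨆ s ∈ Icc t τ, ((c s (stateTraj f t T x₀ α β s) : ℝ) : EReal))
      (((∫ s in t..τ, L s (stateTraj f t T x₀ α β s) (α s) (β s))
        + g τ (stateTraj f t T x₀ α β τ) - z : ℝ) : EReal)

/-- `V₂⁺(t, x, z) = sup_{δ ∈ Δ(t)} inf_{α ∈ 𝒜(t)} J₂(t, x, z, α, δ[α])`. -/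
def V2upper
    (A : Set (EuclideanSpace ℝ (Fin ma))) (B : Set (EuclideanSpace ℝ (Fin mb)))
    (f : ℝ → EuclideanSpace ℝ (Fin n) → EuclideanSpace ℝ (Fin ma) → EuclideanSpace ℝ (Fin mb) →
      EuclideanSpace ℝ (Fin n))
    (L : ℝ → EuclideanSpace ℝ (Fin n) → EuclideanSpace ℝ (Fin ma) → EuclideanSpace ℝ (Fin mb) → ℝ)
    (g c : ℝ → EuclideanSpace ℝ (Fin n) → ℝ)
    (T t : ℝ) (x : EuclideanSpace ℝ (Fin n)) (z : ℝ) : EReal :=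
  ⨆ δ : Strategy A B t T, ⨅ α : ControlSignal A t T,
    costJ2 f L g c t T x z α.1 (δ.1 α).1

/-- `V₂⁻(t, x, z) = inf_{γ ∈ Γ(t)} sup_{β ∈ ℬ(t)} J₂(t, x, z, γ[β], β)`. -/
def V2lower
    (A : Set (EuclideanSpace ℝ (Fin ma))) (B : Set (EuclideanSpace ℝ (Fin mb)))
    (f : ℝ → EuclideanSpace ℝ (Fin n) → EuclideanSpace ℝ (Fin ma) → EuclideanSpace ℝ (Fin mb) →
      EuclideanSpace ℝ (Fin n))
    (L : ℝ → EuclideanSpace ℝ (Fin n) → EuclideanSpace ℝ (Fin ma) → EuclideanSpace ℝ (Fin mb) → ℝ)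
    (g c : ℝ → EuclideanSpace ℝ (Fin n) → ℝ)
    (T t : ℝ) (x : EuclideanSpace ℝ (Fin n)) (z : ℝ) : EReal :=
  ⨅ γ : Strategy B A t T, ⨆ β : ControlSignal B t T,
    costJ2 f L g c t T x z (γ.1 β).1 β.1

/-- The augmented trajectory `(x, z)` of the time-invariant system with freezing control `μ`:
`x' = f(x, α, β) μ`, `z' = -L(x, α, β) μ`, `(x, z)(t) = (x₀, z₀)`. -/
def frozenTraj
    (f : EuclideanSpace ℝ (Fin n) → EuclideanSpace ℝ (Fin ma) → EuclideanSpace ℝ (Fin mb) →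
      EuclideanSpace ℝ (Fin n))
    (L : EuclideanSpace ℝ (Fin n) → EuclideanSpace ℝ (Fin ma) → EuclideanSpace ℝ (Fin mb) → ℝ)
    (t T : ℝ) (x₀ : EuclideanSpace ℝ (Fin n)) (z₀ : ℝ)
    (α : ℝ → EuclideanSpace ℝ (Fin ma)) (β : ℝ → EuclideanSpace ℝ (Fin mb)) (μ : ℝ → ℝ) :
    ℝ → EuclideanSpace ℝ (Fin n) × ℝ :=
  trajectory (fun s y => μ s • (f y.1 (α s) (β s), -L y.1 (α s) (β s))) t T (x₀, z₀)

/-- The fixed-terminal-time cost `J̃ = max { max_{s ∈ [t,T]} c(x(s)), g(x(T)) - z(T) }` along the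
augmented trajectory with freezing control. -/
def costJtilde
    (f : EuclideanSpace ℝ (Fin n) → EuclideanSpace ℝ (Fin ma) → EuclideanSpace ℝ (Fin mb) →
      EuclideanSpace ℝ (Fin n))
    (L : EuclideanSpace ℝ (Fin n) → EuclideanSpace ℝ (Fin ma) → EuclideanSpace ℝ (Fin mb) → ℝ)
    (g c : EuclideanSpace ℝ (Fin n) → ℝ)
    (t T : ℝ) (x₀ : EuclideanSpace ℝ (Fin n)) (z : ℝ)
    (α : ℝ → EuclideanSpace ℝ (Fin ma)) (β : ℝ → EuclideanSpace ℝ (Fin mb)) (μ : ℝ → ℝ) : EReal :=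
  max (⨆ s ∈ Icc t T, ((c (frozenTraj f L t T x₀ z α β μ s).1 : ℝ) : EReal))
    ((g (frozenTraj f L t T x₀ z α β μ T).1 - (frozenTraj f L t T x₀ z α β μ T).2 : ℝ) : EReal)

end Game

end

/-! Augment the state by the remaining budget, with velocity `(f, -L)`. Both costs then become the
cost `stopCost` of stopping an augmented path: at a freely chosen time for the unit-speed path in
J₂, at `T` for the path slowed by μ in J̃. A slowed path is a unit-speed path read on the clock σ(s)
= t + ∫ μ, and `stopCost` is unchanged by such a reparametrization, so choosing μ amounts to
choosing the terminal time σ(T). What remains is to respect non-anticipativity.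

Upper value. A strategy against (α, μ) yields one against α by setting μ = 1; an opponent stopping
at τ is imitated by freezing at τ, since up to τ the two signals coincide. Conversely, α is read on
the running clock, answered there, and the answer is slowed down again (`flow_comp_clock`). This
transfers agreement on [t, s] to agreement on [t, σ(s)] and back.

Lower value. If γ guarantees a value below v, freezing at the first time when stopping costs at most
v is non-anticipative. The reverse inequality is the hard one: given γ and ν, a unit-speed strategy
must do as well against every β. Slowing β down to an input u of (γ, ν) means solving u = β ∘ σ,
where σ is the clock of ν[u] itself, and this need not have a solution. Instead the path Y is
steered near a guide W, the frozen path produced by γ and ν from a fictitious input u, by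
Krasovskii–Subbotin extremal aiming. On each short guide interval, with displacement d = Y - W at
its start, u is a constant b₀ nearly attaining sup_b inf_a ⟨d, F(W, a, b)⟩, while Y answers each
value b of β by a counter-control φ(b) nearly attaining inf_a ⟨d, F(W, a, b)⟩. Both paths spend the
same running time, so the values cancel and |d|² grows only by small errors (`tracking_step`,
`aim_tracking`). Because φ sees the current b, no Isaacs condition is needed. As F is only Borel in
the controls, φ comes from Jankov–von Neumann selection. Lipschitz continuity of the costs turns
closeness of Y and W into closeness of values. -/

/-! ### Universal measurability and measurable selection -/

/-- Inner approximation of the image of Baire space by compact sets. -/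
lemma exists_isCompact_subset_range_lt_measure {X : Type*} [TopologicalSpace X]
    [TopologicalSpace.PseudoMetrizableSpace X] [MeasurableSpace X] [BorelSpace X]
    (μ : Measure X) [IsFiniteMeasure μ] {f : (ℕ → ℕ) → X} (hf : Continuous f)
    {m : ENNReal} (hm : m < μ (range f)) :
    ∃ K ⊆ range f, IsCompact K ∧ m ≤ μ K := by
  let D : ℕ → (ℕ → ℕ) → Set (ℕ → ℕ) := fun n N => {x | ∀ i < n, x i ≤ N i}
  have step : ∀ n N, ∃ k, m < μ (f '' D n N) → m < μ (f '' D (n + 1) (Function.update N n k)) := by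
    intro n N
    by_cases h : m < μ (f '' D n N)
    swap
    · exact ⟨0, fun h' => absurd h' h⟩
    have hU : f '' D n N = ⋃ k : ℕ, f '' D (n + 1) (Function.update N n k) := by
      rw [← image_iUnion]
      congr 1
      ext x
      simp only [D, mem_ofPred_eq, mem_iUnion]
      constructor
      · intro hx
        refine ⟨x n, fun i hi => ?_⟩
        rcases Nat.lt_succ_iff_lt_or_eq.1 hi with hi | rfl
        · rw [Function.update_of_ne hi.ne]; exact hx i hi
        · simp
      · rintro ⟨k, hx⟩ i hi
        have := hx i (hi.trans (Nat.lt_succ_self n))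
        rwa [Function.update_of_ne hi.ne] at this
    have hmono : Monotone fun k : ℕ => f '' D (n + 1) (Function.update N n k) := by
      intro k l hkl
      apply image_mono
      intro x hx i hi
      refine (hx i hi).trans ?_
      by_cases hin : i = n
      · subst hin; simpa using hkl
      · simp [Function.update_of_ne hin]
    -- Continuity from below holds along increasing unions of arbitrary sets, so the images need not
    -- be measurable.
    rw [hU, hmono.measure_iUnion] at h
    obtain ⟨k, hk⟩ := lt_iSup_iff.1 h
    exact ⟨k, fun _ => hk⟩
  choose k hk using step
  let S : ℕ → ℕ → ℕ := fun n => Nat.rec (fun _ => 0) (fun n N => Function.update N n (k n N)) n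
  have hS : ∀ n, S (n + 1) = Function.update (S n) n (k n (S n)) := fun n => rfl
  have hSm : ∀ n, m < μ (f '' D n (S n)) := by
    intro n
    induction n with
    | zero => simpa [D] using hm
    | succ n ih => rw [hS]; exact hk n _ ih
  let N : ℕ → ℕ := fun i => S (i + 1) i
  have hSN : ∀ n i, i < n → S n i = N i := by
    intro n i hi
    induction n, hi using Nat.le_induction with
    | base => rfl
    | succ n hn ih => rw [hS, Function.update_of_ne (by lia), ih]
  have hDm : ∀ n, m < μ (f '' D n N) := by
    intro n
    have : D n N = D n (S n) := by
      ext x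
      simp only [D, mem_ofPred_eq]
      exact forall₂_congr fun i hi => by rw [hSN n i hi]
    rw [this]; exact hSm n
  let Q : Set (ℕ → ℕ) := Set.pi univ fun i => Iic (N i)
  have hQ : IsCompact Q := isCompact_univ_pi fun i => (finite_Iic (N i)).isCompact
  refine ⟨f '' Q, image_subset_range _ _, hQ.image hf, ?_⟩
  -- Continuity from above may fail for the possibly non-measurable sets `f '' D n N`. The bound
  -- passes to the compact image through its open supersets, each of which contains one of them.
  rw [Set.measure_eq_iInf_isOpen]
  refine le_iInf fun U => le_iInf fun hU => le_iInf fun hUo => ?_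
  have : ∃ n, D n N ⊆ f ⁻¹' U := by
    by_contra! hcon
    simp only [not_subset] at hcon
    choose x hxD hxU using hcon
    -- Truncating by `N` moves the points into the compact box and leaves the first `n` coordinates
    -- of the `n`-th point alone, so the untruncated subsequence has the same limit.
    obtain ⟨y, hyQ, φ, hφ, hlim⟩ :=
      hQ.tendsto_subseq (x := fun n i => min (x n i) (N i)) (fun n i _ => by simp)
    have hlim' : Filter.Tendsto (x ∘ φ) Filter.atTop (nhds y) := by
      rw [tendsto_pi_nhds] at hlim ⊢
      intro i
      refine (hlim i).congr' ?_
      filter_upwards [Filter.eventually_gt_atTop i] with n hn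
      simp only [Function.comp]
      exact min_eq_left (hxD _ i (hn.trans_le hφ.le_apply))
    have hy : y ∈ (f ⁻¹' U)ᶜ :=
      (hUo.preimage hf).isClosed_compl.mem_of_tendsto hlim'
        (Filter.Eventually.of_forall fun n => hxU _)
    exact hy (hU ⟨y, hyQ, rfl⟩)
  obtain ⟨n, hn⟩ := this
  exact (hDm n).le.trans (measure_mono (image_subset_iff.2 hn))

/-- Analytic sets are universally measurable. -/
lemma MeasureTheory.AnalyticSet.nullMeasurableSet {X : Type*} [TopologicalSpace X] [T2Space X]
    [TopologicalSpace.PseudoMetrizableSpace X] [MeasurableSpace X] [BorelSpace X]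
    (μ : Measure X) [IsFiniteMeasure μ] {s : Set X} (hs : AnalyticSet s) :
    NullMeasurableSet s μ := by
  rw [AnalyticSet] at hs
  rcases hs with rfl | ⟨f, hf, rfl⟩
  · exact nullMeasurableSet_empty
  by_cases h0 : μ (range f) = 0
  · exact NullMeasurableSet.of_null h0
  obtain ⟨u, -, hu, hlim⟩ := exists_seq_strictMono_tendsto' (pos_iff_ne_zero.2 h0)
  choose K hKs hKc hKm using fun n =>
    exists_isCompact_subset_range_lt_measure μ hf (hu n).2
  have hmeas : MeasurableSet (⋃ n, K n) := MeasurableSet.iUnion fun n => (hKc n).measurableSet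
  refine NullMeasurableSet.congr hmeas.nullMeasurableSet ?_
  refine ae_eq_of_subset_of_measure_ge (iUnion_subset hKs) ?_ hmeas.nullMeasurableSet
    (measure_ne_top _ _)
  exact le_of_tendsto' hlim fun n => (hKm n).trans (measure_mono (subset_iUnion K n))

/-- **Jankov-von Neumann uniformization**: a Borel set which projects onto the whole base
contains the graph of a universally measurable function. -/
lemma exists_universally_measurable_selection {X Y : Type*}
    [TopologicalSpace X] [PolishSpace X] [MeasurableSpace X] [BorelSpace X]
    [TopologicalSpace Y] [PolishSpace Y] [MeasurableSpace Y] [BorelSpace Y]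
    {E : Set (X × Y)} (hE : MeasurableSet E) (hproj : ∀ x, ∃ y, (x, y) ∈ E) :
    ∃ φ : X → Y, (∀ x, (x, φ x) ∈ E) ∧ ∀ μ : Measure X, IsFiniteMeasure μ → AEMeasurable φ μ := by
  rcases isEmpty_or_nonempty X with hX | hX
  · exact ⟨fun x => isEmptyElim x, fun x => isEmptyElim x, fun μ _ =>
      (measurable_of_empty _).aemeasurable⟩
  have hEa : AnalyticSet E := hE.analyticSet
  rw [AnalyticSet] at hEa
  rcases hEa with rfl | ⟨g, hg, hgE⟩
  · obtain ⟨y, hy⟩ := hproj hX.some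
    exact hy.elim
  let C : ℕ → List ℕ → Set X := fun n l => {b | ∃ x, (g x).1 = b ∧ (List.range n).map x = l}
  have hC : ∀ n l, AnalyticSet (C n l) := by
    intro n l
    have : C n l = (fun x => (g x).1) '' {x | (List.range n).map x = l} := by
      ext b; simp only [C, mem_ofPred_eq, mem_image]
      exact exists_congr fun x => and_comm
    rw [this]
    refine IsOpen.analyticSet_image ?_ (by fun_prop)
    have : {x : ℕ → ℕ | (List.range n).map x = l} =
        (fun x (i : Fin n) => x i) ⁻¹' {y | List.ofFn y = l} := by
      ext x
      have : (List.range n).map x = List.ofFn (fun i : Fin n => x i) := by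
        apply List.ext_getElem <;> simp
      simp [this]
    rw [this]
    exact (isOpen_discrete _).preimage (by fun_prop)
  have hne : ∀ n l b, b ∈ C n l → ∃ k, b ∈ C (n + 1) (l ++ [k]) := by
    rintro n l b ⟨x, hx, hxl⟩
    exact ⟨x n, x, hx, by rw [List.range_succ]; simp [hxl]⟩
  -- The least admissible digit at each stage gives the leftmost branch over `b`; minimality makes
  -- the choice expressible through countably many sets `C n l`.
  let nxt : ℕ → List ℕ → X → ℕ := fun n l b => sInf {k | b ∈ C (n + 1) (l ++ [k])}
  let P : X → ℕ → List ℕ := fun b n => Nat.rec [] (fun n l => l ++ [nxt n l b]) n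
  have hP : ∀ b n, P b (n + 1) = P b n ++ [nxt n (P b n) b] := fun b n => rfl
  have hPC : ∀ b n, b ∈ C n (P b n) := by
    intro b n
    induction n with
    | zero =>
      obtain ⟨y, hy⟩ := hproj b
      rw [← hgE] at hy
      obtain ⟨x, hx⟩ := hy
      exact ⟨x, by rw [hx], rfl⟩
    | succ n ih =>
      rw [hP]
      exact Nat.sInf_mem (s := {k | b ∈ C (n + 1) (P b n ++ [k])}) (hne _ _ _ ih)
  let ℓ : X → ℕ → ℕ := fun b n => nxt n (P b n) b
  have hPℓ : ∀ b n, P b n = (List.range n).map (ℓ b) := by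
    intro b n
    induction n with
    | zero => rfl
    | succ n ih => rw [hP, List.range_succ, List.map_append, ← ih]; rfl
  -- Every prefix of the leftmost branch extends to a point of the fibre over `b`. These points
  -- converge to the branch, and the fibre is closed.
  have hgl : ∀ b, (g (ℓ b)).1 = b := by
    intro b
    choose x hxb hxP using fun n => hPC b n
    have hlim : Filter.Tendsto x Filter.atTop (nhds (ℓ b)) := by
      rw [tendsto_pi_nhds]
      intro i
      refine tendsto_const_nhds.congr' ?_
      filter_upwards [Filter.eventually_gt_atTop i] with n hn
      have h := (hxP n).trans (hPℓ b n)
      have := List.map_inj_left.1 h i (List.mem_range.2 hn)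
      exact this.symm
    have h1 : Filter.Tendsto (fun n => (g (x n)).1) Filter.atTop (nhds (g (ℓ b)).1) :=
      ((continuous_fst.comp hg).tendsto _).comp hlim
    simp only [hxb] at h1
    exact tendsto_nhds_unique h1 tendsto_const_nhds
  refine ⟨fun b => (g (ℓ b)).2, fun b => ?_, fun μ _ => ?_⟩
  · have : (b, (g (ℓ b)).2) = g (ℓ b) := Prod.ext (hgl b).symm rfl
    rw [this, ← hgE]
    exact mem_range_self _
  have hCn : ∀ n l, NullMeasurableSet (C n l) μ := fun n l => (hC n l).nullMeasurableSet μ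
  -- Minimality introduces differences of analytic sets. They need not be analytic, but they are
  -- null measurable for every finite measure.
  have hset : ∀ n l k, {b | P b n = l ∧ nxt n l b = k} =
      {b | P b n = l} ∩ (C (n + 1) (l ++ [k]) \ ⋃ j ∈ Iio k, C (n + 1) (l ++ [j])) := by
    intro n l k
    ext b
    simp only [mem_ofPred_eq, mem_inter_iff, mem_sdiff, mem_iUnion, mem_Iio, not_exists]
    refine and_congr_right fun hb => ?_
    have hn : {k | b ∈ C (n + 1) (l ++ [k])}.Nonempty := hne n l b (hb ▸ hPC b n)
    constructor
    · rintro rfl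
      exact ⟨Nat.sInf_mem hn, fun j hj => Nat.notMem_of_lt_sInf hj⟩
    · rintro ⟨h1, h2⟩
      refine le_antisymm (Nat.sInf_le h1) ?_
      by_contra! hlt
      exact h2 _ hlt (Nat.sInf_mem hn)
  have hPn : ∀ n l, NullMeasurableSet {b | P b n = l} μ := by
    intro n
    induction n with
    | zero =>
      intro l
      exact (MeasurableSet.const ([] = l)).nullMeasurableSet
    | succ n ih =>
      intro l'
      have : {b | P b (n + 1) = l'} =
          ⋃ (l : List ℕ) (k : ℕ) (_ : l ++ [k] = l'), {b | P b n = l ∧ nxt n l b = k} := by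
        ext b
        simp only [mem_ofPred_eq, mem_iUnion, hP]
        constructor
        · intro h; exact ⟨_, _, h, rfl, rfl⟩
        · rintro ⟨l, k, h, rfl, rfl⟩; exact h
      rw [this]
      refine NullMeasurableSet.iUnion fun l => .iUnion fun k => .iUnion fun _ => ?_
      rw [hset]
      exact (ih l).inter ((hCn _ _).diff (.biUnion (to_countable _) fun j _ => hCn _ _))
  have hℓ : AEMeasurable ℓ μ := by
    rw [aemeasurable_pi_iff]
    intro n
    refine NullMeasurable.aemeasurable fun s _ => ?_
    have : (fun b => ℓ b n) ⁻¹' s = ⋃ (l : List ℕ) (k ∈ s), {b | P b n = l ∧ nxt n l b = k} := by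
      ext b
      simp only [mem_preimage, mem_iUnion, mem_ofPred_eq]
      constructor
      · intro h; exact ⟨_, _, h, rfl, rfl⟩
      · rintro ⟨l, k, h, rfl, rfl⟩; exact h
    rw [this]
    refine NullMeasurableSet.iUnion fun l => .biUnion (to_countable _) fun k _ => ?_
    rw [hset]
    exact (hPn n l).inter ((hCn _ _).diff (.biUnion (to_countable _) fun j _ => hCn _ _))
  exact (measurable_snd.comp hg.measurable).comp_aemeasurable hℓ

/-! ### Gronwall's inequality and Carathéodory differential equations -/

/-- The primitive of `φ` has right derivative `φ`, so it obeys the differential Gronwall inequality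
with source `a`; inserting the resulting bound into the hypothesis gives the exponential. -/
lemma le_mul_exp_of_le_add_integral {φ : ℝ → ℝ} {t T a K : ℝ} (hφ : ContinuousOn φ (Icc t T))
    (h0 : ∀ s ∈ Icc t T, 0 ≤ φ s) (hK : 0 ≤ K)
    (h : ∀ s ∈ Icc t T, φ s ≤ a + K * ∫ r in t..s, φ r) :
    ∀ s ∈ Icc t T, φ s ≤ a * Real.exp (K * (s - t)) := by
  intro s hs
  have htT : t ≤ T := hs.1.trans hs.2
  have hint : ∀ u ∈ Icc t T, IntervalIntegrable φ volume t u := fun u hu =>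
    ContinuousOn.intervalIntegrable (by
      rw [uIcc_of_le hu.1]; exact hφ.mono (Icc_subset_Icc_right hu.2))
  have hG : ∀ u ∈ Icc t T, ‖∫ r in t..u, φ r‖ ≤ gronwallBound 0 K a (u - t) := by
    refine norm_le_gronwallBound_of_norm_deriv_right_le (f' := φ) ?_ ?_ (by simp) ?_
    · have := intervalIntegral.continuousOn_primitive_interval' (hint T (right_mem_Icc.2 htT))
        left_mem_uIcc
      rwa [uIcc_of_le htT] at this
    · intro u hu
      have hu' := Ico_subset_Icc_self hu
      refine intervalIntegral.integral_hasDerivWithinAt_right (hint u hu')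
        (t := Ioi u) ?_ ?_
      · refine ⟨Icc t T, ?_, (hφ.aestronglyMeasurable measurableSet_Icc)⟩
        exact Filter.mem_of_superset (Ioo_mem_nhdsGT hu.2)
          fun r hr => ⟨hu.1.trans hr.1.le, hr.2.le⟩
      · exact (hφ u hu').mono_of_mem_nhdsWithin (Filter.mem_of_superset (Ioo_mem_nhdsGT hu.2)
          fun r hr => ⟨hu.1.trans hr.1.le, hr.2.le⟩)
    · intro u hu
      have hu' := Ico_subset_Icc_self hu
      have hn : 0 ≤ ∫ r in t..u, φ r :=
        intervalIntegral.integral_nonneg hu.1 fun r hr => h0 r ⟨hr.1, hr.2.trans hu'.2⟩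
      rw [Real.norm_of_nonneg (h0 u hu'), Real.norm_of_nonneg hn]
      linarith [h u hu']
  have h1 := (le_abs_self _).trans (hG s hs)
  have h2 := h s hs
  have h3 : a + K * gronwallBound 0 K a (s - t) = a * Real.exp (K * (s - t)) := by
    rcases eq_or_ne K 0 with rfl | hK0
    · simp
    · rw [gronwallBound_of_K_ne_0 hK0]; field_simp; ring
  rw [← h3]
  exact h2.trans (by gcongr)

section Caratheodory

variable {X : Type*} [NormedAddCommGroup X] [NormedSpace ℝ X]

/-- Right-hand sides on `[t, T]` which are measurable along continuous paths, Lipschitz in the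
state, and bounded at the origin. -/
structure IsCaratheodory (F : ℝ → X → X) (t T : ℝ) (K : ℝ≥0) (M : ℝ) : Prop where
  lipschitz : ∀ s ∈ Icc t T, LipschitzWith K (F s)
  bound : ∀ s ∈ Icc t T, ‖F s 0‖ ≤ M
  measurable : ∀ y : ℝ → X, Continuous y →
    AEStronglyMeasurable (fun s => F s (y s)) (volume.restrict (Icc t T))

lemma ContinuousOn.exists_continuous_eqOn_Icc {Y : Type*} [TopologicalSpace Y] {y : ℝ → Y}
    {t T : ℝ} (htT : t ≤ T) (hy : ContinuousOn y (Icc t T)) :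
    ∃ y' : ℝ → Y, Continuous y' ∧ EqOn y' y (Icc t T) := by
  refine ⟨fun s => y (max t (min s T)), hy.comp_continuous (by fun_prop)
    (fun s => ⟨le_max_left _ _, max_le htT (min_le_right _ _)⟩), fun s hs => ?_⟩
  simp [hs.1, hs.2]

namespace IsCaratheodory

variable {F : ℝ → X → X} {t T : ℝ} {K : ℝ≥0} {M : ℝ}

omit [NormedSpace ℝ X] in
lemma norm_le (hF : IsCaratheodory F t T K M) {s : ℝ} (hs : s ∈ Icc t T) (x : X) :
    ‖F s x‖ ≤ M + K * ‖x‖ := by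
  have h1 := (hF.lipschitz s hs).dist_le_mul x 0
  rw [dist_eq_norm, dist_zero_right] at h1
  have h2 := hF.bound s hs
  have h3 : ‖F s x‖ ≤ ‖F s x - F s 0‖ + ‖F s 0‖ := by
    simpa using norm_add_le (F s x - F s 0) (F s 0)
  linarith

omit [NormedSpace ℝ X] in
lemma integrableOn (hF : IsCaratheodory F t T K M) {y : ℝ → X} (hy : ContinuousOn y (Icc t T)) :
    IntegrableOn (fun s => F s (y s)) (Icc t T) := by
  rcases le_or_gt t T with htT | htT
  swap
  · simp [Icc_eq_empty_of_lt htT]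
  obtain ⟨y', hy', heq⟩ := hy.exists_continuous_eqOn_Icc htT
  refine IntegrableOn.congr_fun (f := fun s => F s (y' s)) ?_
    (fun s hs => by simp only [heq hs]) measurableSet_Icc
  obtain ⟨C, hC⟩ := isCompact_Icc.exists_bound_of_continuousOn hy'.continuousOn (s := Icc t T)
  refine ⟨hF.measurable y' hy', ?_⟩
  refine HasFiniteIntegral.of_bounded (C := M + K * C) ?_
  filter_upwards [ae_restrict_mem measurableSet_Icc] with s hs
  exact (hF.norm_le hs _).trans (by gcongr; exact hC s hs)

omit [NormedSpace ℝ X] in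
lemma intervalIntegrable (hF : IsCaratheodory F t T K M) {y : ℝ → X}
    (hy : ContinuousOn y (Icc t T)) {a b : ℝ} (ha : a ∈ Icc t T) (hb : b ∈ Icc t T) :
    IntervalIntegrable (fun s => F s (y s)) volume a b := by
  rw [intervalIntegrable_iff]
  exact (hF.integrableOn hy).mono_set (uIoc_subset_uIcc.trans (uIcc_subset_Icc ha hb))

/-- Picard iteration in an exponentially weighted norm, which is a contraction on the whole interval
at once, without gluing local solutions. -/
lemma exists_isTrajectory [CompleteSpace X] (hF : IsCaratheodory F t T K M) (htT : t ≤ T)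
    (y₀ : X) : ∃ y, IsTrajectory F t T y₀ y := by
  -- The contraction factor is at most `K / l`, hence at most 1/2. The fixed point `v` is the
  -- solution multiplied by `exp (-(l * (s - t)))`, and `V` undoes this weight.
  set l : ℝ := 2 * K + 1 with hl
  have hlpos : 0 < l := by positivity
  let V : C(Icc t T, X) → ℝ → X := fun v r => Real.exp (l * (r - t)) • v (projIcc t T htT r)
  have hV : ∀ v, Continuous (V v) := fun v => by fun_prop
  have hint : ∀ v, ∀ s ∈ Icc t T, IntervalIntegrable (fun r => F r (V v r)) volume t s :=
    fun v s hs => hF.intervalIntegrable (hV v).continuousOn (left_mem_Icc.2 htT) hs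
  have hprim : ∀ v, ContinuousOn (fun s => ∫ r in t..s, F r (V v r)) (Icc t T) := by
    intro v
    have := intervalIntegral.continuousOn_primitive_interval' (hint v T (right_mem_Icc.2 htT))
      left_mem_uIcc
    rwa [uIcc_of_le htT] at this
  let Q : C(Icc t T, X) → C(Icc t T, X) := fun v =>
    ⟨fun s => Real.exp (-(l * (s - t))) • (y₀ + ∫ r in t..s, F r (V v r)), by
      have := (hprim v).domRestrict
      refine Continuous.smul (by fun_prop) (continuous_const.add this)⟩
  have hQ : ContractingWith (1 / 2) Q := by
    refine ⟨by norm_num, LipschitzWith.of_dist_le_mul fun v v' => ?_⟩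
    rw [ContinuousMap.dist_le (by positivity)]
    rintro ⟨s, hs⟩
    change dist (Real.exp (-(l * (s - t))) • (y₀ + ∫ r in t..s, F r (V v r)))
      (Real.exp (-(l * (s - t))) • (y₀ + ∫ r in t..s, F r (V v' r))) ≤ _
    rw [dist_smul₀, dist_add_left, dist_eq_norm, ← intervalIntegral.integral_sub
      (hint v s hs) (hint v' s hs), Real.norm_of_nonneg (Real.exp_pos _).le]
    have hb : ‖∫ r in t..s, (F r (V v r) - F r (V v' r))‖ ≤
        ∫ r in t..s, (K * dist v v') * Real.exp (l * (r - t)) := by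
      refine intervalIntegral.norm_integral_le_of_norm_le hs.1 ?_
        (Continuous.intervalIntegrable (by fun_prop) _ _)
      refine Filter.Eventually.of_forall fun r hr => ?_
      have hr' : r ∈ Icc t T := ⟨hr.1.le, hr.2.trans hs.2⟩
      rw [← dist_eq_norm]
      refine ((hF.lipschitz r hr').dist_le_mul _ _).trans ?_
      simp only [V]
      rw [dist_smul₀, Real.norm_of_nonneg (Real.exp_pos _).le, mul_assoc, mul_comm (dist v v')]
      gcongr
      exact ContinuousMap.dist_apply_le_dist _
    have hexp : ∫ r in t..s, (K * dist v v') * Real.exp (l * (r - t)) =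
        K * dist v v' * ((Real.exp (l * (s - t)) - 1) / l) := by
      rw [intervalIntegral.integral_const_mul]
      congr 1
      have hd : ∀ r ∈ uIcc t s, HasDerivAt (fun r => Real.exp (l * (r - t)) / l)
          (Real.exp (l * (r - t))) r := by
        intro r _
        have h1 : HasDerivAt (fun r => l * (r - t)) l r := by
          simpa using ((hasDerivAt_id r).sub_const t).const_mul l
        have := h1.exp.div_const l
        rwa [mul_div_cancel_right₀ _ hlpos.ne'] at this
      rw [intervalIntegral.integral_eq_sub_of_hasDerivAt hd
        (Continuous.intervalIntegrable (by fun_prop) _ _)]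
      simp; ring
    rw [hexp] at hb
    calc Real.exp (-(l * (s - t))) * ‖∫ r in t..s, (F r (V v r) - F r (V v' r))‖
        ≤ Real.exp (-(l * (s - t))) * (K * dist v v' * ((Real.exp (l * (s - t)) - 1) / l)) := by
          gcongr
      _ = (K / l) * (1 - Real.exp (-(l * (s - t)))) * dist v v' := by
          have : Real.exp (-(l * (s - t))) * Real.exp (l * (s - t)) = 1 := by
            rw [← Real.exp_add]; simp
          linear_combination (K * dist v v' / l) * this
      _ ≤ (1 / 2) * 1 * dist v v' := by
          have h1 : (K : ℝ) / l ≤ 1 / 2 := by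
            rw [div_le_div_iff₀ hlpos (by norm_num)]; linarith
          have h2 : 1 - Real.exp (-(l * (s - t))) ≤ 1 := by linarith [Real.exp_pos (-(l * (s - t)))]
          have h3 : 0 ≤ 1 - Real.exp (-(l * (s - t))) := by
            have : Real.exp (-(l * (s - t))) ≤ 1 := Real.exp_le_one_iff.2 (by
              have := mul_nonneg hlpos.le (sub_nonneg.2 hs.1); linarith)
            linarith
          gcongr
      _ = _ := by push_cast; ring
  have hfix := hQ.fixedPoint_isFixedPt
  set v := ContractingWith.fixedPoint Q hQ
  have hval : ∀ s ∈ Icc t T, V v s = y₀ + ∫ r in t..s, F r (V v r) := by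
    intro s hs
    have h1 : Q v ⟨s, hs⟩ = v ⟨s, hs⟩ := by rw [hfix]
    change Real.exp (-(l * (s - t))) • (y₀ + ∫ r in t..s, F r (V v r)) = v ⟨s, hs⟩ at h1
    change Real.exp (l * (s - t)) • v (projIcc t T htT s) = _
    rw [projIcc_of_mem htT hs, ← h1, smul_smul, ← Real.exp_add]
    simp
  exact ⟨V v, (hV v).continuousOn, hint v T (right_mem_Icc.2 htT), hval⟩

lemma isTrajectory_trajectory [CompleteSpace X] (hF : IsCaratheodory F t T K M) (htT : t ≤ T)
    (y₀ : X) : IsTrajectory F t T y₀ (trajectory F t T y₀) :=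
  Classical.epsilon_spec (hF.exists_isTrajectory htT y₀)

end IsCaratheodory

/-- Trajectories of right-hand sides agreeing a.e. on `[t, s]` agree on `[t, s]`. -/
lemma IsTrajectory.eqOn {F G : ℝ → X → X} {t T : ℝ} {K : ℝ≥0} {y₀ : X} {y w : ℝ → X}
    (hF : ∀ s ∈ Icc t T, LipschitzWith K (F s))
    (hy : IsTrajectory F t T y₀ y) (hw : IsTrajectory G t T y₀ w) {s : ℝ} (hs : s ≤ T)
    (hFG : ∀ᵐ r ∂(volume.restrict (Icc t s)), F r (w r) = G r (w r)) :
    EqOn y w (Icc t s) := by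
  have hsub : Icc t s ⊆ Icc t T := Icc_subset_Icc_right hs
  have hd : ContinuousOn (fun r => ‖y r - w r‖) (Icc t s) :=
    ((hy.1.mono hsub).sub (hw.1.mono hsub)).norm
  intro r hr
  have key := le_mul_exp_of_le_add_integral (a := 0) (K := K) hd (fun _ _ => norm_nonneg _)
    K.2 ?_ r hr
  · rw [zero_mul] at key
    exact sub_eq_zero.1 (norm_le_zero_iff.1 key)
  intro u hu
  have hI : ∀ {f : ℝ → X}, IntervalIntegrable f volume t T → IntervalIntegrable f volume t u :=
    fun h => h.mono_set (by
      rw [uIcc_of_le hu.1, uIcc_of_le (hu.1.trans (hu.2.trans hs))]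
      exact Icc_subset_Icc_right (hu.2.trans hs))
  rw [hy.2.2 u (hsub hu), hw.2.2 u (hsub hu), add_sub_add_left_eq_sub,
    ← intervalIntegral.integral_sub (hI hy.2.1) (hI hw.2.1), zero_add,
    ← intervalIntegral.integral_const_mul]
  refine intervalIntegral.norm_integral_le_of_norm_le hu.1 ?_ ?_
  · have h1 : ∀ᵐ r ∂volume, r ∈ Icc t s → F r (w r) = G r (w r) :=
      (ae_restrict_iff' measurableSet_Icc).1 hFG
    filter_upwards [h1] with r hr hrm
    have hrm' : r ∈ Icc t s := ⟨hrm.1.le, hrm.2.trans hu.2⟩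
    rw [← hr hrm', ← dist_eq_norm, ← dist_eq_norm]
    exact (hF r (hsub hrm')).dist_le_mul _ _
  · refine ContinuousOn.intervalIntegrable ?_
    rw [uIcc_of_le hu.1]
    exact continuousOn_const.mul (hd.mono (Icc_subset_Icc_right hu.2))

lemma IsTrajectory.norm_le {F : ℝ → X → X} {t T : ℝ} {K : ℝ≥0} {M : ℝ} {y₀ : X} {y : ℝ → X}
    (hF : IsCaratheodory F t T K M) (hM : 0 ≤ M) (hy : IsTrajectory F t T y₀ y) {s : ℝ}
    (hs : s ∈ Icc t T) :
    ‖y s‖ ≤ (‖y₀‖ + M * (T - t)) * Real.exp (K * (T - t)) := by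
  have htT : t ≤ T := hs.1.trans hs.2
  have key := le_mul_exp_of_le_add_integral (a := ‖y₀‖ + M * (T - t)) (K := K) hy.1.norm
    (fun _ _ => norm_nonneg _) K.2 ?_ s hs
  · refine key.trans ?_
    have : 0 ≤ ‖y₀‖ + M * (T - t) :=
      add_nonneg (norm_nonneg _) (mul_nonneg hM (sub_nonneg.2 htT))
    gcongr
    exact hs.2
  intro u hu
  have hcont : ContinuousOn (fun r => ‖y r‖) (uIcc t u) := by
    rw [uIcc_of_le hu.1]; exact (hy.1.mono (Icc_subset_Icc_right hu.2)).norm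
  rw [hy.2.2 u hu, add_assoc]
  refine (norm_add_le _ _).trans (add_le_add_right ?_ _)
  have hcont' : IntervalIntegrable (fun r => K * ‖y r‖) volume t u :=
    (continuousOn_const.mul hcont).intervalIntegrable
  have h1 : ‖∫ r in t..u, F r (y r)‖ ≤ ∫ r in t..u, (M + K * ‖y r‖) := by
    refine intervalIntegral.norm_integral_le_of_norm_le hu.1 ?_ ?_
    · exact Filter.Eventually.of_forall fun r hr => hF.norm_le ⟨hr.1.le, hr.2.trans hu.2⟩ _
    · exact intervalIntegrable_const.add hcont'
  rw [intervalIntegral.integral_add intervalIntegrable_const hcont',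
    intervalIntegral.integral_const_mul,
    intervalIntegral.integral_const, smul_eq_mul] at h1
  have h2 : (u - t) * M ≤ M * (T - t) := by
    rw [mul_comm]; gcongr; exact hu.2
  linarith

lemma IsTrajectory.sub_eq_integral {F : ℝ → X → X} {t T : ℝ} {y₀ : X} {y : ℝ → X}
    (hy : IsTrajectory F t T y₀ y) {a b : ℝ} (ha : a ∈ Icc t T) (hb : b ∈ Icc t T) :
    y b - y a = ∫ r in a..b, F r (y r) := by
  have htT : t ≤ T := ha.1.trans ha.2
  have hI : ∀ u ∈ Icc t T, IntervalIntegrable (fun r => F r (y r)) volume t u := fun u hu =>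
    hy.2.1.mono_set (by
      rw [uIcc_of_le hu.1, uIcc_of_le htT]; exact Icc_subset_Icc_right hu.2)
  rw [hy.2.2 a ha, hy.2.2 b hb, add_sub_add_left_eq_sub,
    intervalIntegral.integral_interval_sub_left (hI b hb) (hI a ha)]

end Caratheodory

/-! ### Signals and the flow of a game -/

section AgreeOn

variable {E : Type*} {t : ℝ}

lemma AgreeOn.refl (s : ℝ) (u : ℝ → E) : AgreeOn t s u u := Filter.Eventually.of_forall fun _ => rfl

lemma AgreeOn.symm {s : ℝ} {u v : ℝ → E} (h : AgreeOn t s u v) : AgreeOn t s v u := by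
  filter_upwards [h] with r hr using hr.symm

lemma AgreeOn.trans {s : ℝ} {u v w : ℝ → E} (h : AgreeOn t s u v) (h' : AgreeOn t s v w) :
    AgreeOn t s u w := by
  filter_upwards [h, h'] with r hr hr' using hr.trans hr'

lemma AgreeOn.mono {s s' : ℝ} {u v : ℝ → E} (h : AgreeOn t s u v) (hs : s' ≤ s) :
    AgreeOn t s' u v :=
  ae_mono (Measure.restrict_mono (Icc_subset_Icc_right hs) le_rfl) h

lemma AgreeOn.of_eqOn {s : ℝ} {u v : ℝ → E} (h : EqOn u v (Icc t s)) : AgreeOn t s u v := by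
  filter_upwards [ae_restrict_mem measurableSet_Icc] with r hr using h hr

lemma AgreeOn.of_eqOn_Ico {s : ℝ} {u v : ℝ → E} (h : EqOn u v (Ico t s)) : AgreeOn t s u v := by
  rw [AgreeOn, ← restrict_Ico_eq_restrict_Icc]
  filter_upwards [ae_restrict_mem measurableSet_Ico] with r hr using h hr

end AgreeOn

section Signals

variable {E : Type*} [NormedAddCommGroup E] {U : Set E} {t T : ℝ}

/-- A measurable function with values in a bounded set is a control signal. -/
def ControlSignal.ofMeasurable (hU : Bornology.IsBounded U) (u : ℝ → E)
    (hm : AEStronglyMeasurable u (volume.restrict (Icc t T))) (hu : ∀ s ∈ Icc t T, u s ∈ U) :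
    ControlSignal U t T :=
  ⟨u, by
    obtain ⟨C, hC⟩ := hU.exists_norm_le
    refine memLp_top_of_bound hm C ?_
    filter_upwards [ae_restrict_mem measurableSet_Icc] with s hs
    exact hC _ (hu s hs), hu⟩

lemma ControlSignal.aestronglyMeasurable (u : ControlSignal U t T) :
    AEStronglyMeasurable u.1 (volume.restrict (Icc t T)) := u.2.1.1

lemma ControlSignal.mem (u : ControlSignal U t T) {s : ℝ} (hs : s ∈ Icc t T) : u.1 s ∈ U :=
  u.2.2 s hs

/-- Constant signals. -/
def ControlSignal.const (a : U) : ControlSignal U t T :=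
  ⟨fun _ => a, memLp_const _, fun _ _ => a.2⟩

lemma isBounded_freezeSet : Bornology.IsBounded freezeSet := Metric.isBounded_Icc 0 1

/-- The signal that runs the clock at unit speed. -/
def runSignal (t T : ℝ) : ControlSignal freezeSet t T :=
  ControlSignal.const ⟨1, by simp [freezeSet]⟩

/-- The signal that freezes the clock at time `τ`. -/
noncomputable def freezeAt (t T τ : ℝ) : ControlSignal freezeSet t T :=
  ControlSignal.ofMeasurable isBounded_freezeSet (fun s => if s ≤ τ then 1 else 0)
    (Measurable.ite measurableSet_Iic measurable_const measurable_const).aestronglyMeasurable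
    (fun s _ => by simp only [freezeSet]; split_ifs <;> simp)

lemma agreeOn_freezeAt_run (τ : ℝ) : AgreeOn t τ (freezeAt t T τ).1 (runSignal t T).1 :=
  AgreeOn.of_eqOn fun _ hr => if_pos hr.2

end Signals

section Flow

variable {EA EB X : Type*} [NormedAddCommGroup EA] [NormedAddCommGroup EB]
  [NormedAddCommGroup X] [NormedSpace ℝ X]
  [MeasurableSpace EA] [MeasurableSpace EB] [MeasurableSpace X]

/-- Vector fields of a differential game: Borel in the controls, uniformly Lipschitz in the state
and uniformly bounded at the origin. -/
structure IsGameField (A : Set EA) (B : Set EB) (F : X → EA → EB → X) (K : ℝ≥0) (M : ℝ) :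
    Prop where
  isCompact_left : IsCompact A
  isCompact_right : IsCompact B
  nonempty_left : A.Nonempty
  nonempty_right : B.Nonempty
  measurable : ∀ y, Measurable (fun p : A × B => F y p.1 p.2)
  lipschitz : ∀ a ∈ A, ∀ b ∈ B, LipschitzWith K (fun y => F y a b)
  bound : ∀ a ∈ A, ∀ b ∈ B, ‖F 0 a b‖ ≤ M

/-- The trajectory of `y' = μ F(y, α, β)`, `y(t) = y₀`. -/
noncomputable def flow (F : X → EA → EB → X) (t T : ℝ) (y₀ : X) (α : ℝ → EA) (β : ℝ → EB)
    (μ : ℝ → ℝ) : ℝ → X :=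
  trajectory (fun s y => μ s • F y (α s) (β s)) t T y₀

variable [BorelSpace EA] [BorelSpace EB] [BorelSpace X] [SecondCountableTopology X]
  {A : Set EA} {B : Set EB} {F : X → EA → EB → X} {K : ℝ≥0} {M : ℝ} {t T : ℝ}

omit [NormedSpace ℝ X] [BorelSpace X] [SecondCountableTopology X] [BorelSpace EA]
  [BorelSpace EB] [MeasurableSpace X] in
lemma ControlSignal.exists_aemeasurable_subtype {E : Type*} [NormedAddCommGroup E]
    [MeasurableSpace E] [BorelSpace E] {U : Set E} (u : ControlSignal U t T) (a₀ : U) :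
    ∃ v : ℝ → U, AEMeasurable v (volume.restrict (Icc t T)) ∧ ∀ s ∈ Icc t T, (v s : E) = u.1 s := by
  classical
  refine ⟨codRestrict (fun s => if s ∈ Icc t T then u.1 s else a₀) U fun s => ?_, ?_, ?_⟩
  · split_ifs with h
    · exact u.mem h
    · exact a₀.2
  · refine AEMeasurable.subtype_mk (AEMeasurable.congr u.aestronglyMeasurable.aemeasurable ?_)
    filter_upwards [ae_restrict_mem measurableSet_Icc] with s hs
    rw [if_pos hs]
  · intro s hs
    simp only [val_codRestrict_apply]
    rw [if_pos hs]

namespace IsGameField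

lemma isCaratheodory (hF : IsGameField A B F K M) (α : ControlSignal A t T)
    (β : ControlSignal B t T) (μ : ControlSignal freezeSet t T) :
    IsCaratheodory (fun s y => μ.1 s • F y (α.1 s) (β.1 s)) t T K M := by
  have hμ : ∀ s ∈ Icc t T, ‖μ.1 s‖ ≤ 1 := fun s hs => by
    have := μ.mem hs
    rw [Real.norm_of_nonneg this.1]; exact this.2
  refine ⟨fun s hs => LipschitzWith.of_dist_le_mul fun x y => ?_, fun s hs => ?_, fun y hy => ?_⟩
  · rw [dist_smul₀]
    have h1 := (hF.lipschitz _ (α.mem hs) _ (β.mem hs)).dist_le_mul x y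
    calc _ ≤ 1 * dist (F x (α.1 s) (β.1 s)) (F y (α.1 s) (β.1 s)) := by
          gcongr; exact hμ s hs
      _ ≤ _ := by rw [one_mul]; exact h1
  · rw [norm_smul]
    calc _ ≤ 1 * ‖F 0 (α.1 s) (β.1 s)‖ := by gcongr; exact hμ s hs
      _ ≤ _ := by rw [one_mul]; exact hF.bound _ (α.mem hs) _ (β.mem hs)
  · obtain ⟨a₀, ha₀⟩ := hF.nonempty_left
    obtain ⟨b₀, hb₀⟩ := hF.nonempty_right
    obtain ⟨α', hα', hαe⟩ := α.exists_aemeasurable_subtype ⟨a₀, ha₀⟩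
    obtain ⟨β', hβ', hβe⟩ := β.exists_aemeasurable_subtype ⟨b₀, hb₀⟩
    have hu : Measurable (Function.uncurry fun y (p : A × B) => F y p.1 p.2) :=
      measurable_uncurry_of_continuous_of_measurable
        (fun p => (hF.lipschitz _ p.1.2 _ p.2.2).continuous) hF.measurable
    refine μ.aestronglyMeasurable.smul ?_
    have h1 := hu.comp_aemeasurable (hy.aemeasurable.prodMk (hα'.prodMk hβ'))
    refine AEStronglyMeasurable.congr h1.aestronglyMeasurable ?_
    filter_upwards [ae_restrict_mem measurableSet_Icc] with s hs
    simp [Function.uncurry, hαe s hs, hβe s hs]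

variable [CompleteSpace X]

lemma isTrajectory_flow (hF : IsGameField A B F K M) (htT : t ≤ T) (y₀ : X)
    (α : ControlSignal A t T) (β : ControlSignal B t T) (μ : ControlSignal freezeSet t T) :
    IsTrajectory (fun s y => μ.1 s • F y (α.1 s) (β.1 s)) t T y₀ (flow F t T y₀ α.1 β.1 μ.1) :=
  (hF.isCaratheodory α β μ).isTrajectory_trajectory htT y₀

lemma flow_initial (hF : IsGameField A B F K M) (htT : t ≤ T) (y₀ : X)
    (α : ControlSignal A t T) (β : ControlSignal B t T) (μ : ControlSignal freezeSet t T) :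
    flow F t T y₀ α.1 β.1 μ.1 t = y₀ := by
  simpa using (hF.isTrajectory_flow htT y₀ α β μ).2.2 t (left_mem_Icc.2 htT)

lemma flow_eqOn (hF : IsGameField A B F K M) (htT : t ≤ T) (y₀ : X)
    {α α' : ControlSignal A t T} {β β' : ControlSignal B t T} {μ μ' : ControlSignal freezeSet t T}
    {s : ℝ} (hs : s ≤ T) (hα : AgreeOn t s α.1 α'.1) (hβ : AgreeOn t s β.1 β'.1)
    (hμ : AgreeOn t s μ.1 μ'.1) :
    EqOn (flow F t T y₀ α.1 β.1 μ.1) (flow F t T y₀ α'.1 β'.1 μ'.1) (Icc t s) := by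
  refine (hF.isTrajectory_flow htT y₀ α β μ).eqOn (hF.isCaratheodory α β μ).lipschitz
    (hF.isTrajectory_flow htT y₀ α' β' μ') hs ?_
  filter_upwards [hα, hβ, hμ] with r h1 h2 h3
  simp only [h1, h2, h3]

/-- Stopping the clock at time `τ` stops the flow at time `τ`. -/
lemma flow_freezeAt (hF : IsGameField A B F K M) (y₀ : X)
    {α α' : ControlSignal A t T} {β β' : ControlSignal B t T} {τ : ℝ} (hτ : τ ∈ Icc t T)
    (hα : AgreeOn t τ α.1 α'.1) (hβ : AgreeOn t τ β.1 β'.1) {s : ℝ} (hs : s ∈ Icc t T) :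
    flow F t T y₀ α.1 β.1 (freezeAt t T τ).1 s =
      flow F t T y₀ α'.1 β'.1 (runSignal t T).1 (min s τ) := by
  have htT : t ≤ T := hs.1.trans hs.2
  have key := hF.flow_eqOn htT y₀ hτ.2 hα hβ (agreeOn_freezeAt_run τ (T := T))
  rcases le_total s τ with hsτ | hsτ
  · rw [min_eq_left hsτ]
    exact key ⟨hs.1, hsτ⟩
  · rw [min_eq_right hsτ, ← key ⟨hτ.1, le_rfl⟩, ← sub_eq_zero,
      (hF.isTrajectory_flow htT y₀ α β (freezeAt t T τ)).sub_eq_integral hτ hs]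
    refine intervalIntegral.integral_zero_ae (Filter.Eventually.of_forall fun r hr => ?_)
    rw [uIoc_of_le hsτ] at hr
    have : (freezeAt t T τ).1 r = 0 := if_neg hr.1.not_ge
    rw [this, zero_smul]

/-- Flows are bounded and Lipschitz in time, uniformly over all controls. -/
lemma exists_bound (hF : IsGameField A B F K M) (t T : ℝ) (y₀ : X) : ∃ C : ℝ, 0 ≤ C ∧
    ∀ (α : ControlSignal A t T) (β : ControlSignal B t T) (μ : ControlSignal freezeSet t T),
      (∀ s ∈ Icc t T, ‖flow F t T y₀ α.1 β.1 μ.1 s‖ ≤ C) ∧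
      (∀ r ∈ Icc t T, ∀ s ∈ Icc t T, r ≤ s →
        ‖flow F t T y₀ α.1 β.1 μ.1 s - flow F t T y₀ α.1 β.1 μ.1 r‖ ≤ C * (s - r)) := by
  have hM : 0 ≤ M := by
    obtain ⟨a₀, ha₀⟩ := hF.nonempty_left
    obtain ⟨b₀, hb₀⟩ := hF.nonempty_right
    exact (norm_nonneg _).trans (hF.bound a₀ ha₀ b₀ hb₀)
  rcases le_or_gt t T with htT | htT
  swap
  · exact ⟨0, le_rfl, fun α β μ => by simp [Icc_eq_empty_of_lt htT]⟩
  set R := (‖y₀‖ + M * (T - t)) * Real.exp (K * (T - t)) with hR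
  have hR0 : 0 ≤ R := by
    have : 0 ≤ T - t := sub_nonneg.2 htT
    positivity
  refine ⟨max R (M + K * R), le_max_of_le_left hR0, fun α β μ => ?_⟩
  have htr := hF.isTrajectory_flow htT y₀ α β μ
  have hC := hF.isCaratheodory α β μ
  have h1 : ∀ s ∈ Icc t T, ‖flow F t T y₀ α.1 β.1 μ.1 s‖ ≤ R := fun s hs => htr.norm_le hC hM hs
  refine ⟨fun s hs => (h1 s hs).trans (le_max_left _ _), fun r hr s hs hrs => ?_⟩
  rw [htr.sub_eq_integral hr hs]
  have := intervalIntegral.norm_integral_le_of_norm_le_const (a := r) (b := s)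
    (C := max R (M + K * R))
    (f := fun u => μ.1 u • F (flow F t T y₀ α.1 β.1 μ.1 u) (α.1 u) (β.1 u))
    fun u hu => by
      rw [uIoc_of_le hrs] at hu
      have hu' : u ∈ Icc t T := ⟨hr.1.trans hu.1.le, hu.2.trans hs.2⟩
      refine (hC.norm_le hu' _).trans (le_trans ?_ (le_max_right _ _))
      gcongr
      exact h1 u hu'
  rwa [abs_of_nonneg (sub_nonneg.2 hrs)] at this

end IsGameField

end Flow

/-! ### Stopping a path, and freezing it at a given time -/

section StopCost

variable {X : Type*}

/-- The cost of stopping the path `y` at time `τ`: the largest value of `c` up to `τ`, or the value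
of `h` at `τ`. -/
noncomputable def stopCost (c h : X → ℝ) (t : ℝ) (y : ℝ → X) (τ : ℝ) : EReal :=
  max (⨆ s ∈ Icc t τ, ((c (y s) : ℝ) : EReal)) ((h (y τ) : ℝ) : EReal)

lemma stopCost_le_coe_iff {c h : X → ℝ} {t : ℝ} {y : ℝ → X} {τ v : ℝ} :
    stopCost c h t y τ ≤ (v : EReal) ↔ (∀ s ∈ Icc t τ, c (y s) ≤ v) ∧ h (y τ) ≤ v := by
  simp [stopCost, EReal.coe_le_coe_iff]

/-- The cost sees only the points visited and the endpoint, so a time change that maps `[t, T]` onto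
`[t, σ T]` only moves the stopping time. -/
lemma stopCost_comp {c h : X → ℝ} {t T : ℝ} {y y' : ℝ → X} {σ : ℝ → ℝ} (htT : t ≤ T)
    (hσ : σ '' Icc t T = Icc t (σ T)) (hy : ∀ s ∈ Icc t T, y' s = y (σ s)) :
    stopCost c h t y' T = stopCost c h t y (σ T) := by
  unfold stopCost
  rw [hy T ⟨htT, le_rfl⟩, ← hσ, iSup_image]
  congr 1
  exact biSup_congr fun s hs => by rw [hy s hs]

lemma image_min_Icc {t T τ : ℝ} (hτ : τ ∈ Icc t T) :
    (fun s => min s τ) '' Icc t T = Icc t (min T τ) := by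
  rw [min_eq_right hτ.2]
  ext r
  constructor
  · rintro ⟨s, hs, rfl⟩
    exact ⟨le_min hs.1 hτ.1, min_le_right _ _⟩
  · intro hr
    exact ⟨r, ⟨hr.1, hr.2.trans hτ.2⟩, min_eq_left hr.2⟩

/-- The times at which stopping `y` costs at most `v`. -/
def goodTimes (c h : X → ℝ) (t T v : ℝ) (y : ℝ → X) : Set ℝ :=
  {τ | τ ∈ Icc t T ∧ (∀ s ∈ Icc t τ, c (y s) ≤ v) ∧ h (y τ) ≤ v}

lemma goodTimes_congr {c h : X → ℝ} {t T v : ℝ} {y y' : ℝ → X} {s : ℝ} (hy : EqOn y y' (Icc t s))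
    {τ : ℝ} (hτ : τ ≤ s) (h' : τ ∈ goodTimes c h t T v y) : τ ∈ goodTimes c h t T v y' := by
  obtain ⟨h1, h2, h3⟩ := h'
  refine ⟨h1, fun r hr => ?_, ?_⟩
  · rw [← hy ⟨hr.1, hr.2.trans hτ⟩]; exact h2 r hr
  · rw [← hy ⟨h1.1, hτ⟩]; exact h3

/-- The terminal condition is closed, and the state constraint is inherited by earlier stopping
times; hence only `h` has to be continuous. -/
lemma sInf_goodTimes_mem [TopologicalSpace X] {c h : X → ℝ} {t T v : ℝ} {y : ℝ → X}
    (hh : Continuous h) (hy : ContinuousOn y (Icc t T)) (hne : (goodTimes c h t T v y).Nonempty) :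
    sInf (goodTimes c h t T v y) ∈ goodTimes c h t T v y := by
  have hbdd : BddBelow (goodTimes c h t T v y) := ⟨t, fun τ hτ => hτ.1.1⟩
  have hcl : IsClosed (Icc t T ∩ {τ | h (y τ) ≤ v}) :=
    (hh.comp_continuousOn hy).preimage_isClosed_of_isClosed isClosed_Icc isClosed_Iic
  have hmem := hcl.closure_subset_iff.2 (fun τ hτ => ⟨hτ.1, hτ.2.2⟩) (csInf_mem_closure hne hbdd)
  refine ⟨hmem.1, fun s hs => ?_, hmem.2⟩
  obtain ⟨τ, hτ⟩ := hne
  exact hτ.2.1 s ⟨hs.1, hs.2.trans (csInf_le hbdd hτ)⟩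

end StopCost

section Freezing

variable {EA EB X : Type*} [NormedAddCommGroup EA] [NormedAddCommGroup EB]
  [NormedAddCommGroup X] [NormedSpace ℝ X]
  [MeasurableSpace EA] [MeasurableSpace EB] [MeasurableSpace X]
  [BorelSpace EA] [BorelSpace EB] [BorelSpace X] [SecondCountableTopology X] [CompleteSpace X]
  {A : Set EA} {B : Set EB} {F : X → EA → EB → X} {K : ℝ≥0} {M : ℝ} {t T : ℝ}

lemma IsGameField.stopCost_flow_freezeAt (hF : IsGameField A B F K M) (c h : X → ℝ) (y₀ : X)
    {α α' : ControlSignal A t T} {β β' : ControlSignal B t T} {τ : ℝ} (hτ : τ ∈ Icc t T)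
    (hα : AgreeOn t τ α.1 α'.1) (hβ : AgreeOn t τ β.1 β'.1) :
    stopCost c h t (flow F t T y₀ α.1 β.1 (freezeAt t T τ).1) T =
      stopCost c h t (flow F t T y₀ α'.1 β'.1 (runSignal t T).1) τ := by
  have := stopCost_comp (c := c) (h := h) (hτ.1.trans hτ.2) (image_min_Icc hτ)
    (fun s hs => hF.flow_freezeAt y₀ hτ hα hβ hs)
  rwa [min_eq_right hτ.2] at this

/-- Freezing controls give the minimizer at least the power of choosing a terminal time. -/
lemma IsGameField.iSup_pairStrategy_le (hF : IsGameField A B F K M) (c h : X → ℝ) (y₀ : X) :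
    (⨆ δ : PairStrategy A freezeSet B t T, ⨅ (α : ControlSignal A t T)
        (μ : ControlSignal freezeSet t T), stopCost c h t (flow F t T y₀ α.1 (δ.1 α μ).1 μ.1) T) ≤
      ⨆ δ : Strategy A B t T, ⨅ α : ControlSignal A t T, ⨅ τ ∈ Icc t T,
        stopCost c h t (flow F t T y₀ α.1 (δ.1 α).1 (runSignal t T).1) τ := by
  refine iSup_le fun δ => ?_
  -- Up to `τ` the signal frozen at `τ` is indistinguishable from full speed, so answering as if the
  -- clock always ran loses nothing.
  let δ' : Strategy A B t T := ⟨fun α => δ.1 α (runSignal t T), fun s hs u u' hu =>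
    δ.2 s hs u u' _ _ hu (AgreeOn.refl _ _)⟩
  refine le_iSup_of_le δ' (le_iInf fun α => le_iInf₂ fun τ hτ => ?_)
  refine iInf₂_le_of_le α (freezeAt t T τ) (le_of_eq ?_)
  exact hF.stopCost_flow_freezeAt c h y₀ hτ (AgreeOn.refl _ _)
    (δ.2 τ hτ _ _ _ _ (AgreeOn.refl _ _) (agreeOn_freezeAt_run τ))

/-- Stopping at the first time at which the cost is low enough is non-anticipative. -/
lemma IsGameField.iInf_strategy_pair_le (hF : IsGameField A B F K M) {c h : X → ℝ}
    (hh : Continuous h) (htT : t ≤ T) (y₀ : X) :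
    (⨅ (γ : Strategy B A t T) (ν : Strategy B freezeSet t T), ⨆ β : ControlSignal B t T,
        stopCost c h t (flow F t T y₀ (γ.1 β).1 β.1 (ν.1 β).1) T) ≤
      ⨅ γ : Strategy B A t T, ⨆ β : ControlSignal B t T, ⨅ τ ∈ Icc t T,
        stopCost c h t (flow F t T y₀ (γ.1 β).1 β.1 (runSignal t T).1) τ := by
  refine le_iInf fun γ => ?_
  rw [← EReal.le_of_forall_lt_iff_le]
  intro v hv
  let Y : ControlSignal B t T → ℝ → X := fun β => flow F t T y₀ (γ.1 β).1 β.1 (runSignal t T).1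
  have hmem : ∀ β, sInf (goodTimes c h t T v (Y β)) ∈ goodTimes c h t T v (Y β) := by
    intro β
    refine sInf_goodTimes_mem hh (hF.isTrajectory_flow htT y₀ _ _ _).1 ?_
    have h1 := (le_iSup (fun β : ControlSignal B t T => ⨅ τ ∈ Icc t T,
      stopCost c h t (flow F t T y₀ (γ.1 β).1 β.1 (runSignal t T).1) τ) β).trans_lt hv
    simp only [iInf_lt_iff] at h1
    obtain ⟨τ, hτ, hτv⟩ := h1
    exact ⟨τ, hτ, stopCost_le_coe_iff.1 hτv.le⟩
  have hY : ∀ s ∈ Icc t T, ∀ β β' : ControlSignal B t T, AgreeOn t s β.1 β'.1 →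
      EqOn (Y β) (Y β') (Icc t s) := fun s hs β β' hβ =>
    hF.flow_eqOn htT y₀ hs.2 (γ.2 s hs _ _ hβ) hβ (AgreeOn.refl _ _)
  -- A first good time occurring by `s` is determined by the input on `[t, s]`. If neither input has
  -- produced one by `s`, both clocks still run at full speed there; these are the two cases for
  -- `ν`.
  have hle : ∀ s ∈ Icc t T, ∀ β β' : ControlSignal B t T, AgreeOn t s β.1 β'.1 →
      sInf (goodTimes c h t T v (Y β)) ≤ s →
      sInf (goodTimes c h t T v (Y β')) ≤ sInf (goodTimes c h t T v (Y β)) :=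
    fun s hs β β' hβ hb => csInf_le ⟨t, fun τ hτ => hτ.1.1⟩
      (goodTimes_congr (hY s hs β β' hβ) hb (hmem β))
  let ν : Strategy B freezeSet t T := ⟨fun β => freezeAt t T (sInf (goodTimes c h t T v (Y β))), by
    intro s hs β β' hβ
    rcases le_or_gt (sInf (goodTimes c h t T v (Y β))) s with hs1 | hs1
    · have h1 := hle s hs β β' hβ hs1
      have h2 := hle s hs β' β hβ.symm (h1.trans hs1)
      have heq := le_antisymm h2 h1
      change AgreeOn t s (freezeAt t T (sInf (goodTimes c h t T v (Y β)))).1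
        (freezeAt t T (sInf (goodTimes c h t T v (Y β')))).1
      rw [heq]
      exact AgreeOn.refl _ _
    · have hs2 : s < sInf (goodTimes c h t T v (Y β')) := by
        by_contra! hcon
        exact absurd ((hle s hs β' β hβ.symm hcon).trans hcon) hs1.not_ge
      exact ((agreeOn_freezeAt_run _).mono hs1.le).trans
        ((agreeOn_freezeAt_run _).mono hs2.le).symm⟩
  refine iInf₂_le_of_le γ ν (iSup_le fun β => ?_)
  have h1 := hF.stopCost_flow_freezeAt c h y₀ (hmem β).1 (AgreeOn.refl _ (γ.1 β).1)
    (AgreeOn.refl _ β.1)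
  refine h1.trans_le (stopCost_le_coe_iff.2 (hmem β).2)

end Freezing

/-! ### Reparametrization by the clock -/

/-- The running time elapsed up to `s` when the clock runs at speed `μ`. -/
noncomputable def clock (t : ℝ) (μ : ℝ → ℝ) (s : ℝ) : ℝ := t + ∫ r in t..s, μ r

/-- The image of the clock speed as a measure on `[t, s]`. -/
noncomputable def clockMeasure (t : ℝ) (μ : ℝ → ℝ) (s : ℝ) : Measure ℝ :=
  (volume.restrict (Icc t s)).withDensity fun r => ENNReal.ofReal (μ r)

/-- The first time at which the clock shows `r` (or its final value). -/
noncomputable def clockInv (t T : ℝ) (μ : ℝ → ℝ) (r : ℝ) : ℝ :=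
  sInf {u | u ∈ Icc t T ∧ min r (clock t μ T) ≤ clock t μ u}

section Clock

variable {t T : ℝ} (μ : ControlSignal freezeSet t T)

lemma clock_intervalIntegrable {a b : ℝ} (ha : a ∈ Icc t T) (hb : b ∈ Icc t T) :
    IntervalIntegrable μ.1 volume a b := by
  rw [intervalIntegrable_iff]
  exact IntegrableOn.mono_set (memLp_one_iff_integrable.1 (μ.2.1.mono_exponent le_top))
    (uIoc_subset_uIcc.trans (uIcc_subset_Icc ha hb))

lemma clock_start : clock t μ.1 t = t := by simp [clock]

lemma clock_sub {a b : ℝ} (ha : a ∈ Icc t T) (hb : b ∈ Icc t T) :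
    clock t μ.1 b - clock t μ.1 a = ∫ r in a..b, μ.1 r := by
  have ht : t ∈ Icc t T := left_mem_Icc.2 (ha.1.trans ha.2)
  rw [clock, clock, add_sub_add_left_eq_sub, intervalIntegral.integral_interval_sub_left
    (clock_intervalIntegrable μ ht hb) (clock_intervalIntegrable μ ht ha)]

lemma clock_mono {a b : ℝ} (ha : a ∈ Icc t T) (hb : b ∈ Icc t T) (hab : a ≤ b) :
    clock t μ.1 a ≤ clock t μ.1 b := by
  rw [← sub_nonneg, clock_sub μ ha hb]
  exact intervalIntegral.integral_nonneg hab
    fun r hr => (μ.mem ⟨ha.1.trans hr.1, hr.2.trans hb.2⟩).1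

lemma clock_sub_le {a b : ℝ} (ha : a ∈ Icc t T) (hb : b ∈ Icc t T) (hab : a ≤ b) :
    clock t μ.1 b - clock t μ.1 a ≤ b - a := by
  rw [clock_sub μ ha hb]
  have := intervalIntegral.integral_mono_on hab (clock_intervalIntegrable μ ha hb)
    (intervalIntegrable_const (c := (1 : ℝ)))
    fun r hr => (μ.mem ⟨ha.1.trans hr.1, hr.2.trans hb.2⟩).2
  simpa using this

lemma clock_continuousOn : ContinuousOn (clock t μ.1) (Icc t T) := by
  rcases le_or_gt t T with htT | htT
  swap
  · simp [Icc_eq_empty_of_lt htT]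
  have := intervalIntegral.continuousOn_primitive_interval'
    (clock_intervalIntegrable μ (left_mem_Icc.2 htT) (right_mem_Icc.2 htT)) left_mem_uIcc
  rw [uIcc_of_le htT] at this
  exact continuousOn_const.add this

lemma le_clock {s : ℝ} (hs : s ∈ Icc t T) : t ≤ clock t μ.1 s := by
  have := clock_mono μ (left_mem_Icc.2 (hs.1.trans hs.2)) hs hs.1
  rwa [clock_start] at this

lemma clock_le {s : ℝ} (hs : s ∈ Icc t T) : clock t μ.1 s ≤ s := by
  have := clock_sub_le μ (left_mem_Icc.2 (hs.1.trans hs.2)) hs hs.1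
  rw [clock_start] at this
  linarith

lemma clock_mem {s : ℝ} (hs : s ∈ Icc t T) : clock t μ.1 s ∈ Icc t T :=
  ⟨le_clock μ hs, (clock_le μ hs).trans hs.2⟩

lemma clock_image {s : ℝ} (hs : s ∈ Icc t T) :
    clock t μ.1 '' Icc t s = Icc t (clock t μ.1 s) := by
  have ht : t ∈ Icc t T := left_mem_Icc.2 (hs.1.trans hs.2)
  have hsub : Icc t s ⊆ Icc t T := Icc_subset_Icc_right hs.2
  refine Subset.antisymm ?_ ?_
  · rintro _ ⟨r, hr, rfl⟩
    exact ⟨le_clock μ (hsub hr), clock_mono μ (hsub hr) hs hr.2⟩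
  · have := intermediate_value_Icc hs.1 ((clock_continuousOn μ).mono hsub)
    rwa [clock_start] at this

lemma clock_congr {μ μ' : ControlSignal freezeSet t T} {s : ℝ}
    (h : AgreeOn t s μ.1 μ'.1) {r : ℝ} (hr : r ∈ Icc t s) : clock t μ.1 r = clock t μ'.1 r := by
  unfold clock
  congr 1
  refine intervalIntegral.integral_congr_ae ?_
  have h1 := (ae_restrict_iff' measurableSet_Icc).1 h
  filter_upwards [h1] with u hu hur
  rw [uIoc_of_le hr.1] at hur
  exact hu ⟨hur.1.le, hur.2.trans hr.2⟩

/-- A continuous monotone clock has intervals as sublevel sets, so measure identities such as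
`map_clock` reduce to values at endpoints. -/
lemma exists_isGreatest_clock_le {s a : ℝ} (hs : s ∈ Icc t T) (ha : t ≤ a) :
    ∃ u ∈ Icc t s, {r | r ∈ Icc t s ∧ clock t μ.1 r ≤ a} = Icc t u ∧
      clock t μ.1 u = min a (clock t μ.1 s) := by
  have hsub : Icc t s ⊆ Icc t T := Icc_subset_Icc_right hs.2
  have hcl : IsClosed (Icc t s ∩ {r | clock t μ.1 r ≤ a}) :=
    ((clock_continuousOn μ).mono hsub).preimage_isClosed_of_isClosed isClosed_Icc isClosed_Iic
  have hco : IsCompact (Icc t s ∩ {r | clock t μ.1 r ≤ a}) :=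
    isCompact_Icc.of_isClosed_subset hcl inter_subset_left
  obtain ⟨u, hu, hmax⟩ := hco.exists_isGreatest ⟨t, left_mem_Icc.2 hs.1, by
    simpa [clock_start] using ha⟩
  refine ⟨u, hu.1, ?_, ?_⟩
  · ext r
    refine ⟨fun hr => ⟨hr.1.1, hmax hr⟩, fun hr => ?_⟩
    have hr' : r ∈ Icc t s := ⟨hr.1, hr.2.trans hu.1.2⟩
    exact ⟨hr', (clock_mono μ (hsub hr') (hsub hu.1) hr.2).trans hu.2⟩
  · refine le_antisymm (le_min hu.2 (clock_mono μ (hsub hu.1) hs hu.1.2)) ?_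
    have hmem : min a (clock t μ.1 s) ∈ clock t μ.1 '' Icc t s := by
      rw [clock_image μ hs]
      exact ⟨le_min ha (le_clock μ hs), min_le_right _ _⟩
    obtain ⟨r, hr, hra⟩ := hmem
    rw [← hra]
    exact clock_mono μ (hsub hr) (hsub hu.1) (hmax ⟨hr, hra.le.trans (min_le_left _ _)⟩)

lemma lintegral_clock {a b : ℝ} (ha : a ∈ Icc t T) (hb : b ∈ Icc t T) (hab : a ≤ b) :
    ∫⁻ r in Icc a b, ENNReal.ofReal (μ.1 r) =
      ENNReal.ofReal (clock t μ.1 b - clock t μ.1 a) := by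
  rw [clock_sub μ ha hb, intervalIntegral.integral_of_le hab, ← integral_Icc_eq_integral_Ioc,
    ofReal_integral_eq_lintegral_ofReal]
  · have := clock_intervalIntegrable μ ha hb
    rw [intervalIntegrable_iff, uIoc_of_le hab] at this
    rwa [← IntegrableOn, integrableOn_Icc_iff_integrableOn_Ioc]
  · filter_upwards [ae_restrict_mem measurableSet_Icc] with r hr
    exact (μ.mem ⟨ha.1.trans hr.1, hr.2.trans hb.2⟩).1

lemma clockMeasure_absolutelyContinuous (s : ℝ) :
    clockMeasure t μ.1 s ≪ volume.restrict (Icc t s) :=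
  withDensity_absolutelyContinuous _ _

lemma aemeasurable_clock {s : ℝ} (hs : s ∈ Icc t T) :
    AEMeasurable (clock t μ.1) (clockMeasure t μ.1 s) :=
  (((clock_continuousOn μ).mono (Icc_subset_Icc_right hs.2)).aemeasurable
    measurableSet_Icc).mono_ac (clockMeasure_absolutelyContinuous μ s)

lemma ae_clockMeasure_iff {s : ℝ} (hs : s ∈ Icc t T) {p : ℝ → Prop} :
    (∀ᵐ r ∂clockMeasure t μ.1 s, p r) ↔ ∀ᵐ r ∂(volume.restrict (Icc t s)), 0 < μ.1 r → p r := by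
  have hm : AEMeasurable μ.1 (volume.restrict (Icc t s)) :=
    μ.aestronglyMeasurable.aemeasurable.mono_measure
      (Measure.restrict_mono (Icc_subset_Icc_right hs.2) le_rfl)
  rw [clockMeasure, ae_withDensity_iff' hm.ennreal_ofReal]
  simp

/-- The clock transports its speed to Lebesgue measure. -/
lemma map_clock {s : ℝ} (hs : s ∈ Icc t T) :
    (clockMeasure t μ.1 s).map (clock t μ.1) = volume.restrict (Icc t (clock t μ.1 s)) := by
  symm
  refine Measure.ext_of_Iic _ _ fun a => ?_
  rw [Measure.map_apply_of_aemeasurable (aemeasurable_clock μ hs) measurableSet_Iic,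
    clockMeasure, withDensity_apply', Measure.restrict_apply measurableSet_Iic,
    Measure.restrict_restrict' measurableSet_Icc]
  have hset : clock t μ.1 ⁻¹' Iic a ∩ Icc t s = {r | r ∈ Icc t s ∧ clock t μ.1 r ≤ a} := by
    ext r; simp only [mem_inter_iff, mem_preimage, mem_Iic, mem_ofPred_eq]; exact and_comm
  rw [hset]
  rcases lt_or_ge a t with hat | hat
  · have h1 : {r | r ∈ Icc t s ∧ clock t μ.1 r ≤ a} = ∅ := by
      ext r
      simp only [mem_ofPred_eq, mem_empty_iff_false, iff_false, not_and, not_le]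
      exact fun hr => hat.trans_le (le_clock μ ⟨hr.1, hr.2.trans hs.2⟩)
    have h2 : Iic a ∩ Icc t (clock t μ.1 s) = ∅ := by
      ext r
      simp only [mem_inter_iff, mem_Iic, mem_Icc, mem_empty_iff_false, iff_false, not_and]
      intro h1 h2; linarith
    rw [h1, h2]
    simp
  · obtain ⟨u, hu, huset, huc⟩ := exists_isGreatest_clock_le μ hs hat
    rw [huset, lintegral_clock μ (left_mem_Icc.2 (hs.1.trans hs.2)) ⟨hu.1, hu.2.trans hs.2⟩ hu.1,
      huc, clock_start]
    have : Iic a ∩ Icc t (clock t μ.1 s) = Icc t (min a (clock t μ.1 s)) := by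
      ext r; simp only [mem_inter_iff, mem_Iic, mem_Icc, le_min_iff]; tauto
    rw [this, Real.volume_Icc]

lemma integral_comp_clock {X : Type*} [NormedAddCommGroup X] [NormedSpace ℝ X] {s : ℝ}
    (hs : s ∈ Icc t T) {G : ℝ → X}
    (hG : AEStronglyMeasurable G (volume.restrict (Icc t (clock t μ.1 s)))) :
    ∫ r in t..clock t μ.1 s, G r = ∫ r in t..s, μ.1 r • G (clock t μ.1 r) := by
  have hm : AEMeasurable μ.1 (volume.restrict (Icc t s)) :=
    μ.aestronglyMeasurable.aemeasurable.mono_measure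
      (Measure.restrict_mono (Icc_subset_Icc_right hs.2) le_rfl)
  rw [intervalIntegral.integral_of_le (le_clock μ hs), intervalIntegral.integral_of_le hs.1,
    ← integral_Icc_eq_integral_Ioc, ← integral_Icc_eq_integral_Ioc, ← map_clock μ hs,
    integral_map (aemeasurable_clock μ hs) (by rwa [map_clock μ hs]), clockMeasure,
    integral_withDensity_eq_integral_toReal_smul₀ hm.ennreal_ofReal (by simp)]
  refine integral_congr_ae ?_
  filter_upwards [ae_restrict_mem measurableSet_Icc] with r hr
  rw [ENNReal.toReal_ofReal (μ.mem ⟨hr.1, hr.2.trans hs.2⟩).1]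

lemma ae_comp_clock {s : ℝ} (hs : s ∈ Icc t T) {p : ℝ → Prop}
    (h : ∀ᵐ r ∂(volume.restrict (Icc t (clock t μ.1 s))), p r) :
    ∀ᵐ r ∂(volume.restrict (Icc t s)), 0 < μ.1 r → p (clock t μ.1 r) := by
  rw [← ae_clockMeasure_iff μ hs]
  rw [← map_clock μ hs] at h
  exact ae_of_ae_map (aemeasurable_clock μ hs) h

lemma clockInv_mem (htT : t ≤ T) (r : ℝ) : clockInv t T μ.1 r ∈ Icc t T := by
  have hmem : T ∈ {u | u ∈ Icc t T ∧ min r (clock t μ.1 T) ≤ clock t μ.1 u} :=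
    ⟨right_mem_Icc.2 htT, min_le_right _ _⟩
  exact ⟨le_csInf ⟨T, hmem⟩ fun u hu => hu.1.1, csInf_le ⟨t, fun u hu => hu.1.1⟩ hmem⟩

lemma clockInv_monotone (htT : t ≤ T) : Monotone (clockInv t T μ.1) := fun _ _ hab =>
  csInf_le_csInf ⟨t, fun _ hu => hu.1.1⟩ ⟨T, right_mem_Icc.2 htT, min_le_right _ _⟩
    fun _ hu => ⟨hu.1, (min_le_min_right _ hab).trans hu.2⟩

lemma clockInv_clock_le {u : ℝ} (hu : u ∈ Icc t T) : clockInv t T μ.1 (clock t μ.1 u) ≤ u :=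
  csInf_le ⟨t, fun _ hu => hu.1.1⟩ ⟨hu, min_le_left _ _⟩

/-- Inversion fails at `u` only if the clock is flat on some `[q, u]` with `q` rational. For each
`q` such `u` lie in one flat stretch, which has clock measure zero, and there are countably many
`q`. -/
lemma clockInv_clock_ae {s : ℝ} (hs : s ∈ Icc t T) :
    ∀ᵐ u ∂clockMeasure t μ.1 s, clockInv t T μ.1 (clock t μ.1 u) = u := by
  have htT : t ≤ T := hs.1.trans hs.2
  have hsub : Icc t s ⊆ Icc t T := Icc_subset_Icc_right hs.2
  have hq : ∀ q : ℚ, (q : ℝ) ∈ Icc t s →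
      ∀ᵐ u ∂clockMeasure t μ.1 s,
        ¬ (u ∈ Icc t s ∧ (q : ℝ) < u ∧ clock t μ.1 u ≤ clock t μ.1 q) := by
    intro q hqm
    obtain ⟨v, hv, hvset, hvc⟩ := exists_isGreatest_clock_le μ hs (le_clock μ (hsub hqm))
    rw [ae_iff]
    simp only [not_not]
    refine measure_mono_null (t := Icc (q : ℝ) v) (fun u hu => ⟨hu.2.1.le, ?_⟩) ?_
    · have : u ∈ {r | r ∈ Icc t s ∧ clock t μ.1 r ≤ clock t μ.1 q} := ⟨hu.1, hu.2.2⟩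
      rw [hvset] at this
      exact this.2
    · have hqv : (q : ℝ) ≤ v := by
        have : (q : ℝ) ∈ {r | r ∈ Icc t s ∧ clock t μ.1 r ≤ clock t μ.1 q} := ⟨hqm, le_rfl⟩
        rw [hvset] at this
        exact this.2
      rw [clockMeasure, withDensity_apply', Measure.restrict_restrict' measurableSet_Icc,
        inter_eq_left.2 (Icc_subset_Icc hqm.1 hv.2), lintegral_clock μ (hsub hqm) (hsub hv) hqv,
        hvc]
      simp
  have hall : ∀ᵐ u ∂clockMeasure t μ.1 s, ∀ q : ℚ, (q : ℝ) ∈ Icc t s →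
      ¬ (u ∈ Icc t s ∧ (q : ℝ) < u ∧ clock t μ.1 u ≤ clock t μ.1 q) := by
    rw [ae_all_iff]
    intro q
    by_cases hqm : (q : ℝ) ∈ Icc t s
    · filter_upwards [hq q hqm] with u hu _ using hu
    · exact Filter.Eventually.of_forall fun u h => absurd h hqm
  have hmem : ∀ᵐ u ∂clockMeasure t μ.1 s, u ∈ Icc t s :=
    (clockMeasure_absolutelyContinuous μ s) (ae_restrict_mem measurableSet_Icc)
  filter_upwards [hall, hmem] with u hu hus
  refine le_antisymm (clockInv_clock_le μ (hsub hus)) ?_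
  by_contra! hlt
  obtain ⟨q, hq1, hq2⟩ := exists_rat_btwn hlt
  have hq0 : t ≤ (q : ℝ) := (clockInv_mem μ htT _).1.trans hq1.le
  have hqm : (q : ℝ) ∈ Icc t s := ⟨hq0, hq2.le.trans hus.2⟩
  refine hu q hqm ⟨hus, hq2, ?_⟩
  obtain ⟨v, hv, hvq⟩ := exists_lt_of_csInf_lt
    (s := {v | v ∈ Icc t T ∧ min (clock t μ.1 u) (clock t μ.1 T) ≤ clock t μ.1 v})
    ⟨T, right_mem_Icc.2 htT, min_le_right _ _⟩ hq1
  refine le_trans ?_ (clock_mono μ hv.1 (hsub hqm) hvq.le)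
  have := hv.2
  rwa [min_eq_left (clock_mono μ (hsub hus) (right_mem_Icc.2 htT) (hsub hus).2)] at this

/-- Since the clock measure is absolutely continuous, the preimage of a null set under the inverse
clock is null on the running interval. This makes reading a signal on the running clock compatible
with almost-everywhere equality. -/
lemma map_clockInv {s : ℝ} (hs : s ∈ Icc t T) :
    (volume.restrict (Icc t (clock t μ.1 s))).map (clockInv t T μ.1) = clockMeasure t μ.1 s := by
  rw [← map_clock μ hs, AEMeasurable.map_map_of_aemeasurable
    (clockInv_monotone μ (hs.1.trans hs.2)).measurable.aemeasurable (aemeasurable_clock μ hs)]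
  have h : clockInv t T μ.1 ∘ clock t μ.1 =ᵐ[clockMeasure t μ.1 s] id := clockInv_clock_ae μ hs
  rw [Measure.map_congr h, Measure.map_id]

lemma ae_comp_clockInv {s : ℝ} (hs : s ∈ Icc t T) {p : ℝ → Prop}
    (h : ∀ᵐ r ∂(volume.restrict (Icc t s)), p r) :
    ∀ᵐ r ∂(volume.restrict (Icc t (clock t μ.1 s))), p (clockInv t T μ.1 r) := by
  have h1 := (clockMeasure_absolutelyContinuous μ s).ae_le h
  rw [← map_clockInv μ hs] at h1
  exact ae_of_ae_map (clockInv_monotone μ (hs.1.trans hs.2)).measurable.aemeasurable h1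

/-- The first time at which the clock shows a value reached by time `s` does not depend on the speed
after `s`. -/
lemma clockInv_congr {μ μ' : ControlSignal freezeSet t T} {s : ℝ} (hs : s ∈ Icc t T)
    (h : AgreeOn t s μ.1 μ'.1) {r : ℝ} (hr : r ≤ clock t μ.1 s) :
    clockInv t T μ.1 r = clockInv t T μ'.1 r := by
  have htT : t ≤ T := hs.1.trans hs.2
  have hT := right_mem_Icc.2 htT
  have key : ∀ μ μ' : ControlSignal freezeSet t T, AgreeOn t s μ.1 μ'.1 → r ≤ clock t μ.1 s →
      clockInv t T μ'.1 r ≤ clockInv t T μ.1 r := by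
    intro μ μ' h hr
    have hss : s ∈ Icc t s := ⟨hs.1, le_rfl⟩
    have hr' : r ≤ clock t μ'.1 s := by rwa [← clock_congr h hss]
    have hmin : min r (clock t μ.1 T) = r := min_eq_left (hr.trans (clock_mono μ hs hT hs.2))
    have hmin' : min r (clock t μ'.1 T) = r := min_eq_left (hr'.trans (clock_mono μ' hs hT hs.2))
    refine le_csInf ⟨T, hT, min_le_right _ _⟩ fun u hu => ?_
    rw [mem_ofPred_eq, hmin] at hu
    rcases le_total u s with hus | hus
    · refine csInf_le ⟨t, fun _ hu => hu.1.1⟩ ⟨hu.1, ?_⟩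
      rw [hmin', ← clock_congr h ⟨hu.1.1, hus⟩]
      exact hu.2
    · refine le_trans (csInf_le ⟨t, fun _ hu => hu.1.1⟩ ⟨hs, ?_⟩) hus
      rw [hmin']
      exact hr'
  refine le_antisymm (key μ' μ h.symm ?_) (key μ μ' h hr)
  rwa [← clock_congr h ⟨hs.1, le_rfl⟩]

end Clock

section TimeChange

variable {EA EB X : Type*} [NormedAddCommGroup EA] [NormedAddCommGroup EB]
  [NormedAddCommGroup X] [NormedSpace ℝ X]
  [MeasurableSpace EA] [MeasurableSpace EB] [MeasurableSpace X]
  [BorelSpace EA] [BorelSpace EB] [BorelSpace X] [SecondCountableTopology X] [CompleteSpace X]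
  {A : Set EA} {B : Set EB} {F : X → EA → EB → X} {K : ℝ≥0} {M : ℝ} {t T : ℝ}

/-- The signal `α` read on the clock running at speed `μ`. -/
noncomputable def ControlSignal.unfreeze (hA : Bornology.IsBounded A) (htT : t ≤ T)
    (α : ControlSignal A t T) (μ : ControlSignal freezeSet t T) : ControlSignal A t T :=
  ControlSignal.ofMeasurable hA (fun r => α.1 (clockInv t T μ.1 r))
    (by
      have hT := right_mem_Icc.2 htT
      -- Beyond the final reading of the clock the inverse is constant; before it, `map_clockInv`
      -- gives measurability.
      suffices AEStronglyMeasurable (fun r => α.1 (clockInv t T μ.1 r)) (volume.restrict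
          (Icc t (clock t μ.1 T) ∪ Ioc (clock t μ.1 T) T)) by
        rwa [Icc_union_Ioc_eq_Icc (clock_mem μ hT).1 (clock_mem μ hT).2] at this
      rw [aestronglyMeasurable_union_iff]
      constructor
      · refine AEStronglyMeasurable.comp_aemeasurable ?_
          (clockInv_monotone μ htT).measurable.aemeasurable
        rw [map_clockInv μ hT]
        exact α.aestronglyMeasurable.mono_ac (clockMeasure_absolutelyContinuous μ T)
      · refine (aestronglyMeasurable_const
          (b := α.1 (clockInv t T μ.1 (clock t μ.1 T)))).congr ?_
        filter_upwards [ae_restrict_mem measurableSet_Ioc] with r hr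
        simp only [clockInv, min_self, min_eq_right hr.1.le])
    (fun r _ => α.mem (clockInv_mem μ htT r))

/-- The signal `β` slowed down to the clock running at speed `μ`, with value `b₀` while the clock
stands still. -/
noncomputable def ControlSignal.refreeze (hB : Bornology.IsBounded B) (b₀ : B)
    (β : ControlSignal B t T) (μ : ControlSignal freezeSet t T) : ControlSignal B t T :=
  ControlSignal.ofMeasurable hB (fun s => ({r | 0 < μ.1 r}.indicator
      (fun r => β.1 (clock t μ.1 r) - b₀) s) + b₀)
    (by
      rcases le_or_gt t T with htT | htT
      swap
      · simp [Icc_eq_empty_of_lt htT]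
      have hT := right_mem_Icc.2 htT
      have hβ : AEStronglyMeasurable β.1 (volume.restrict (Icc t (clock t μ.1 T))) :=
        β.aestronglyMeasurable.mono_measure
          (Measure.restrict_mono (Icc_subset_Icc_right (clock_mem μ hT).2) le_rfl)
      -- Composition with the clock can blow up a null set on a flat stretch. The measurable version
      -- therefore agrees with `β` after composition only where `μ` is positive, which is where the
      -- indicator lives.
      obtain ⟨β', hβ'm, hβ'⟩ := hβ
      have hcl : AEMeasurable (clock t μ.1) (volume.restrict (Icc t T)) :=
        (clock_continuousOn μ).aemeasurable measurableSet_Icc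
      have hset : NullMeasurableSet {r | 0 < μ.1 r} (volume.restrict (Icc t T)) :=
        nullMeasurableSet_lt aemeasurable_const μ.aestronglyMeasurable.aemeasurable
      refine AEStronglyMeasurable.add ?_ aestronglyMeasurable_const
      have h1 : AEStronglyMeasurable (fun r => β' (clock t μ.1 r) - (b₀ : EB))
          (volume.restrict (Icc t T)) :=
        (hβ'm.aestronglyMeasurable.comp_aemeasurable hcl).sub aestronglyMeasurable_const
      refine (h1.indicator₀ hset).congr ?_
      filter_upwards [ae_comp_clock μ hT hβ'] with r hr
      by_cases h : 0 < μ.1 r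
      · simp [indicator, h, hr h]
      · simp [indicator, h])
    (fun s hs => by
      by_cases h : 0 < μ.1 s
      · simpa [indicator, h] using β.mem (clock_mem μ hs)
      · simp [indicator, h])

omit [MeasurableSpace EB] [BorelSpace EB] in
lemma ControlSignal.refreeze_of_pos {hB : Bornology.IsBounded B} {b₀ : B}
    {β : ControlSignal B t T} {μ : ControlSignal freezeSet t T} {s : ℝ} (h : 0 < μ.1 s) :
    (ControlSignal.refreeze hB b₀ β μ).1 s = β.1 (clock t μ.1 s) := by
  simp [ControlSignal.refreeze, ControlSignal.ofMeasurable, indicator, h]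

omit [MeasurableSpace EB] [BorelSpace EB] in
lemma ControlSignal.refreeze_of_not_pos {hB : Bornology.IsBounded B} {b₀ : B}
    {β : ControlSignal B t T} {μ : ControlSignal freezeSet t T} {s : ℝ} (h : ¬ 0 < μ.1 s) :
    (ControlSignal.refreeze hB b₀ β μ).1 s = b₀ := by
  simp [ControlSignal.refreeze, ControlSignal.ofMeasurable, indicator, h]

/-- Chain rule: the slowed path has velocity `μ` times the field. Almost everywhere that `μ` is
positive, the two time changes of `α` cancel; where `μ` vanishes the controls are irrelevant.
Uniqueness identifies the paths. -/
lemma IsGameField.flow_comp_clock (hF : IsGameField A B F K M) (htT : t ≤ T) (y₀ : X)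
    (hA : Bornology.IsBounded A) (hB : Bornology.IsBounded B) (b₀ : B)
    (α : ControlSignal A t T) (β : ControlSignal B t T) (μ : ControlSignal freezeSet t T) {s : ℝ}
    (hs : s ∈ Icc t T) :
    flow F t T y₀ α.1 (ControlSignal.refreeze hB b₀ β μ).1 μ.1 s =
      flow F t T y₀ (ControlSignal.unfreeze hA htT α μ).1 β.1 (runSignal t T).1
        (clock t μ.1 s) := by
  have hY := hF.isTrajectory_flow htT y₀ (ControlSignal.unfreeze hA htT α μ) β (runSignal t T)
  set Y := flow F t T y₀ (ControlSignal.unfreeze hA htT α μ).1 β.1 (runSignal t T).1 with hYdef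
  have hC := hF.isCaratheodory α (ControlSignal.refreeze hB b₀ β μ) μ
  have hcont : ContinuousOn (fun s => Y (clock t μ.1 s)) (Icc t T) :=
    hY.1.comp (clock_continuousOn μ) fun r hr => clock_mem μ hr
  have hW : IsTrajectory (fun s y => μ.1 s • F y (α.1 s)
      ((ControlSignal.refreeze hB b₀ β μ).1 s)) t T y₀ (fun s => Y (clock t μ.1 s)) := by
    refine ⟨hcont, hC.intervalIntegrable hcont (left_mem_Icc.2 htT) (right_mem_Icc.2 htT),
      fun r hr => ?_⟩
    simp only []
    rw [hY.2.2 _ (clock_mem μ hr), integral_comp_clock μ hr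
      (((hF.isCaratheodory _ β (runSignal t T)).integrableOn hY.1).aestronglyMeasurable.mono_measure
        (Measure.restrict_mono (Icc_subset_Icc_right (clock_mem μ hr).2) le_rfl))]
    congr 1
    refine intervalIntegral.integral_congr_ae ?_
    have h1 := (ae_restrict_iff' measurableSet_Icc).1
      ((ae_clockMeasure_iff μ hr).1 (clockInv_clock_ae μ hr))
    filter_upwards [h1] with u hu hum
    rw [uIoc_of_le hr.1] at hum
    have hum' : u ∈ Icc t r := ⟨hum.1.le, hum.2⟩
    by_cases hpos : 0 < μ.1 u
    · rw [ControlSignal.refreeze_of_pos hpos]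
      have h2 : (ControlSignal.unfreeze hA htT α μ).1 (clock t μ.1 u) = α.1 u :=
        congrArg α.1 (hu hum' hpos)
      have h3 : (runSignal t T).1 (clock t μ.1 u) = 1 := rfl
      rw [h2, h3, one_smul]
    · have : μ.1 u = 0 :=
        le_antisymm (not_lt.1 hpos) (μ.mem (Icc_subset_Icc_right hr.2 hum')).1
      simp [this]
  exact (hF.isTrajectory_flow htT y₀ α _ μ).eqOn hC.lipschitz hW le_rfl
    (Filter.Eventually.of_forall fun _ => rfl) hs

/-- A maximizer answering a freezing opponent can read the opponent's signal on the running
clock. -/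
lemma IsGameField.iSup_strategy_le (hF : IsGameField A B F K M) (c h : X → ℝ) (htT : t ≤ T)
    (y₀ : X) :
    (⨆ δ : Strategy A B t T, ⨅ α : ControlSignal A t T, ⨅ τ ∈ Icc t T,
        stopCost c h t (flow F t T y₀ α.1 (δ.1 α).1 (runSignal t T).1) τ) ≤
      ⨆ δ : PairStrategy A freezeSet B t T, ⨅ (α : ControlSignal A t T)
        (μ : ControlSignal freezeSet t T),
          stopCost c h t (flow F t T y₀ α.1 (δ.1 α μ).1 μ.1) T := by
  have hA := hF.isCompact_left.isBounded
  have hB := hF.isCompact_right.isBounded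
  obtain ⟨b₀, hb₀⟩ := hF.nonempty_right
  have hT := right_mem_Icc.2 htT
  refine iSup_le fun δ => ?_
  let δ' : PairStrategy A freezeSet B t T :=
    ⟨fun α μ => ControlSignal.refreeze hB ⟨b₀, hb₀⟩ (δ.1 (ControlSignal.unfreeze hA htT α μ)) μ, by
      intro s hs α α' μ μ' hα hμ
      -- Agreement up to `s` becomes agreement up to the common clock reading at `s`, where `δ`
      -- applies; slowing down brings it back. The fixed value `b₀` secures agreement while the
      -- clock stands still.
      have h1 : AgreeOn t (clock t μ.1 s) (ControlSignal.unfreeze hA htT α μ).1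
          (ControlSignal.unfreeze hA htT α' μ').1 := by
        filter_upwards [ae_comp_clockInv μ hs hα, ae_restrict_mem measurableSet_Icc] with r hr hrm
        change α.1 (clockInv t T μ.1 r) = α'.1 (clockInv t T μ'.1 r)
        rw [hr, clockInv_congr hs hμ hrm.2]
      have h2 := ae_comp_clock μ hs (δ.2 _ (clock_mem μ hs) _ _ h1)
      filter_upwards [h2, hμ, ae_restrict_mem measurableSet_Icc] with r hr hμr hrm
      by_cases hpos : 0 < μ.1 r
      · have hpos' : 0 < μ'.1 r := hμr ▸ hpos
        rw [ControlSignal.refreeze_of_pos hpos, ControlSignal.refreeze_of_pos hpos', hr hpos,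
          clock_congr hμ hrm]
      · have hpos' : ¬ 0 < μ'.1 r := hμr ▸ hpos
        rw [ControlSignal.refreeze_of_not_pos hpos, ControlSignal.refreeze_of_not_pos hpos']⟩
  refine le_iSup_of_le δ' (le_iInf₂ fun α μ => ?_)
  refine iInf_le_of_le (ControlSignal.unfreeze hA htT α μ)
    (iInf₂_le_of_le (clock t μ.1 T) (clock_mem μ hT) (le_of_eq ?_))
  exact (stopCost_comp htT (clock_image μ hT)
    fun s hs => hF.flow_comp_clock htT y₀ hA hB ⟨b₀, hb₀⟩ α _ μ hs).symm

end TimeChange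

/-! ### Extremal aiming with a guide -/

section Splice

variable {E : Type*} [NormedAddCommGroup E] {U : Set E} {t T : ℝ}

/-- The signal equal to `u` before time `r` and to `v` from time `r` on. -/
noncomputable def ControlSignal.splice (hU : Bornology.IsBounded U) (u v : ControlSignal U t T)
    (r : ℝ) : ControlSignal U t T :=
  ControlSignal.ofMeasurable hU ((Iio r).piecewise u.1 v.1)
    (AEStronglyMeasurable.piecewise measurableSet_Iio
      (u.aestronglyMeasurable.mono_measure Measure.restrict_le_self)
      (v.aestronglyMeasurable.mono_measure Measure.restrict_le_self))
    (fun s hs => by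
      by_cases h : s ∈ Iio r
      · simpa [piecewise, h] using u.mem hs
      · simpa [piecewise, h] using v.mem hs)

lemma ControlSignal.splice_of_lt {hU : Bornology.IsBounded U} {u v : ControlSignal U t T}
    {r s : ℝ} (h : s < r) : (ControlSignal.splice hU u v r).1 s = u.1 s :=
  piecewise_eq_of_mem (Iio r) u.1 v.1 h

lemma ControlSignal.splice_of_le {hU : Bornology.IsBounded U} {u v : ControlSignal U t T}
    {r s : ℝ} (h : r ≤ s) : (ControlSignal.splice hU u v r).1 s = v.1 s :=
  piecewise_eq_of_notMem (Iio r) u.1 v.1 (not_lt.2 h)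

end Splice

section Selector

variable {EA EB : Type*} [NormedAddCommGroup EA] [NormedAddCommGroup EB]
  [MeasurableSpace EA] [MeasurableSpace EB] {A : Set EA} {B : Set EB} {t T : ℝ}

/-- Universally measurable counter-controls. -/
def Selector (A : Set EA) (B : Set EB) : Type _ :=
  {φ : B → A // ∀ μ : Measure B, IsFiniteMeasure μ → AEMeasurable φ μ}

open Classical in
/-- A retraction of the ambient space onto a nonempty set. -/
noncomputable def Set.Nonempty.retract {E : Type*} {U : Set E} (hU : U.Nonempty) (x : E) : U :=
  if h : x ∈ U then ⟨x, h⟩ else ⟨hU.some, hU.some_mem⟩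

lemma Set.Nonempty.retract_of_mem {E : Type*} {U : Set E} (hU : U.Nonempty) {x : E} (h : x ∈ U) :
    hU.retract x = ⟨x, h⟩ := dif_pos h

/-- The signal obtained by applying a counter-control at each time. -/
noncomputable def Selector.respond [BorelSpace EA] [BorelSpace EB] [SecondCountableTopology EA]
    (hA : Bornology.IsBounded A) (hB : B.Nonempty)
    (φ : Selector A B) (β : ControlSignal B t T) : ControlSignal A t T :=
  ControlSignal.ofMeasurable hA
    (fun s => φ.1 (hB.retract (β.1 s)))
    (by
      obtain ⟨β', hβ', hβe⟩ := β.exists_aemeasurable_subtype ⟨hB.some, hB.some_mem⟩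
      have h1 : AEMeasurable (fun s => (φ.1 (β' s) : EA)) (volume.restrict (Icc t T)) :=
        measurable_subtype_coe.comp_aemeasurable
          ((φ.2 _ (Measure.isFiniteMeasure_map _ _)).comp_aemeasurable hβ')
      refine h1.aestronglyMeasurable.congr ?_
      filter_upwards [ae_restrict_mem measurableSet_Icc] with s hs
      have h2 : hB.retract (β.1 s) = β' s :=
        (hB.retract_of_mem (β.mem hs)).trans (Subtype.ext (hβe s hs).symm)
      rw [h2])
    (fun s _ => (φ.1 _).2)

lemma Selector.respond_apply [BorelSpace EA] [BorelSpace EB] [SecondCountableTopology EA]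
    {hA : Bornology.IsBounded A} {hB : B.Nonempty}
    {φ : Selector A B} {β : ControlSignal B t T} {s : ℝ} (hs : s ∈ Icc t T) :
    (φ.respond hA hB β).1 s = φ.1 ⟨β.1 s, β.mem hs⟩ := by
  simp [respond, ControlSignal.ofMeasurable, hB.retract_of_mem (β.mem hs)]

lemma Selector.respond_agreeOn [BorelSpace EA] [BorelSpace EB] [SecondCountableTopology EA]
    {hA : Bornology.IsBounded A} {hB : B.Nonempty}
    {φ : Selector A B} {β β' : ControlSignal B t T} {s : ℝ}
    (h : AgreeOn t s β.1 β'.1) : AgreeOn t s (φ.respond hA hB β).1 (φ.respond hA hB β').1 := by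
  filter_upwards [h] with r hr
  simp [respond, ControlSignal.ofMeasurable, hr]

end Selector

section Tracking

variable {EA EB X : Type*} [NormedAddCommGroup EA] [NormedAddCommGroup EB]
  [NormedAddCommGroup X] [NormedSpace ℝ X]
  [MeasurableSpace EA] [MeasurableSpace EB] [MeasurableSpace X]
  [BorelSpace EA] [BorelSpace EB] [BorelSpace X]
  {A : Set EA} {B : Set EB} {F : X → EA → EB → X} {K : ℝ≥0} {M : ℝ} {t T : ℝ}

/-- In the direction `l`, some control of the second player and some counter-control of the first
player are nearly optimal. -/
lemma IsGameField.exists_saddle (hF : IsGameField A B F K M) (w : X) (l : X →L[ℝ] ℝ) {ε : ℝ}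
    (hε : 0 < ε) :
    ∃ (b₀ : B) (φ : Selector A B) (v : ℝ), (∀ b : B, l (F w (φ.1 b) b) ≤ v + ε) ∧
      ∀ a ∈ A, v ≤ l (F w a b₀) + ε := by
  have : Nonempty A := hF.nonempty_left.to_subtype
  have : Nonempty B := hF.nonempty_right.to_subtype
  have : CompactSpace A := isCompact_iff_compactSpace.1 hF.isCompact_left
  have : CompactSpace B := isCompact_iff_compactSpace.1 hF.isCompact_right
  let f : A → B → ℝ := fun a b => l (F w a b)
  have hfb : ∀ a b, |f a b| ≤ ‖l‖ * (K * ‖w‖ + M) := by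
    intro a b
    have h1 := l.le_opNorm (F w a b)
    have h2 := (hF.lipschitz a a.2 b b.2).dist_le_mul w 0
    rw [dist_eq_norm, dist_zero_right] at h2
    have h3 := norm_add_le (F w a b - F 0 a b) (F 0 a b)
    rw [sub_add_cancel] at h3
    have h4 := hF.bound a a.2 b b.2
    refine h1.trans ?_
    gcongr
    linarith
  set R := ‖l‖ * (K * ‖w‖ + M)
  have hbelow : ∀ b, BddBelow (range fun a => f a b) := fun b =>
    ⟨-R, by rintro _ ⟨a, rfl⟩; exact (abs_le.1 (hfb a b)).1⟩
  have habove : BddAbove (range fun b => ⨅ a, f a b) := by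
    refine ⟨R, ?_⟩
    rintro _ ⟨b, rfl⟩
    exact (ciInf_le (hbelow b) (Classical.arbitrary A)).trans (abs_le.1 (hfb _ b)).2
  -- The lower value: the counter-control may depend on `b`, so no minimax equality enters.
  set v := ⨆ b, ⨅ a, f a b
  obtain ⟨b₀, hb₀⟩ := exists_lt_of_lt_ciSup (show v - ε < ⨆ b, ⨅ a, f a b by
    change v - ε < v; linarith)
  have hmeas : Measurable fun p : B × A => f p.2 p.1 :=
    l.measurable.comp ((hF.measurable w).comp measurable_swap)
  -- The slack `ε` makes every fibre nonempty although the infimum over `a` need not be attained.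
  obtain ⟨φ, hφE, hφ⟩ := exists_universally_measurable_selection
    (E := {p : B × A | f p.2 p.1 < v + ε}) (measurableSet_lt hmeas measurable_const) (by
      intro b
      have h1 : ⨅ a, f a b < v + ε := (le_ciSup habove b).trans_lt (by linarith)
      obtain ⟨a, ha⟩ := exists_lt_of_ciInf_lt h1
      exact ⟨a, ha⟩)
  refine ⟨b₀, ⟨φ, hφ⟩, v, fun b => (hφE b).le, fun a ha => ?_⟩
  have := ciInf_le (hbelow b₀) ⟨a, ha⟩
  simp only [f] at this hb₀
  linarith

variable [SecondCountableTopology X] [CompleteSpace X]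

/-- One step of extremal aiming: while the guide `W` runs on `[s, s']` at speed `μ` and the path `Y`
runs at unit speed for the same total time, their distance grows by little. -/
lemma IsGameField.tracking_step (hF : IsGameField A B F K M) (y₀ : X)
    (q : X →L[ℝ] X →L[ℝ] ℝ) (hsymm : ∀ x y, q x y = q y x) (hpos : ∀ x, ‖x‖ ^ 2 ≤ q x x)
    {α α' : ControlSignal A t T} {β u : ControlSignal B t T} {μ : ControlSignal freezeSet t T}
    {C δ ε v s s' : ℝ} {Y W : ℝ → X}
    (hYdef : Y = flow F t T y₀ α.1 β.1 (runSignal t T).1)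
    (hWdef : W = flow F t T y₀ α'.1 u.1 μ.1)
    (hC0 : 0 ≤ C)
    (hYC : ∀ s ∈ Icc t T, ‖Y s‖ ≤ C) (hWC : ∀ s ∈ Icc t T, ‖W s‖ ≤ C)
    (hYL : ∀ r ∈ Icc t T, ∀ s ∈ Icc t T, r ≤ s → ‖Y s - Y r‖ ≤ C * (s - r))
    (hWL : ∀ r ∈ Icc t T, ∀ s ∈ Icc t T, r ≤ s → ‖W s - W r‖ ≤ C * (s - r))
    (hε : 0 ≤ ε)
    (hs : s ∈ Icc t T) (hs' : s' ∈ Icc t T) (hss' : s ≤ s') (hδ : s' - s ≤ δ)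
    (hα : ∀ x ∈ Ico (clock t μ.1 s) (clock t μ.1 s'),
      q (Y (clock t μ.1 s) - W s) (F (W s) (α.1 x) (β.1 x)) ≤ v + ε)
    (hu : ∀ x ∈ Ico s s', ∀ a ∈ A,
      v ≤ q (Y (clock t μ.1 s) - W s) (F (W s) a (u.1 x)) + ε) :
    q (Y (clock t μ.1 s') - W s') (Y (clock t μ.1 s') - W s') ≤
      (1 + 2 * ‖q‖ * K * δ) * q (Y (clock t μ.1 s) - W s) (Y (clock t μ.1 s) - W s) +
        δ * (4 * ε + (8 * ‖q‖ * K * C ^ 2 + 4 * ‖q‖ * C ^ 2) * δ) := by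
  have htT : t ≤ T := hs.1.trans hs.2
  set r := clock t μ.1 s with hr
  set r' := clock t μ.1 s' with hr'
  have hrm : r ∈ Icc t T := clock_mem μ hs
  have hrm' : r' ∈ Icc t T := clock_mem μ hs'
  have hrr' : r ≤ r' := clock_mono μ hs hs' hss'
  have hm : r' - r ≤ δ := (clock_sub_le μ hs hs' hss').trans hδ
  have hδ0 : 0 ≤ δ := (sub_nonneg.2 hss').trans hδ
  set d := Y r - W s with hd
  have htrY := hF.isTrajectory_flow htT y₀ α β (runSignal t T)
  have htrW := hF.isTrajectory_flow htT y₀ α' u μ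
  rw [← hYdef] at htrY
  rw [← hWdef] at htrW
  have hqle : ∀ x y, |q x y| ≤ ‖q‖ * ‖x‖ * ‖y‖ := fun x y => q.le_opNorm₂ x y
  have hdC : ‖d‖ ≤ 2 * C := by
    have := norm_sub_le (Y r) (W s)
    linarith [hYC r hrm, hWC s hs]
  have hFle : ∀ a ∈ A, ∀ b ∈ B, ∀ x,
      |q d (F x a b) - q d (F (W s) a b)| ≤ ‖q‖ * ‖d‖ * (K * ‖x - W s‖) := by
    intro a ha b hb x
    rw [← map_sub]
    refine (hqle _ _).trans ?_
    gcongr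
    have := (hF.lipschitz a ha b hb).dist_le_mul x (W s)
    rwa [dist_eq_norm, dist_eq_norm] at this
  -- The path sees the field at `Y x` instead of `W s`, at distance at most `‖d‖ + C * δ`; the
  -- Lipschitz bound turns this into the error term.
  have hP : q d (Y r' - Y r) ≤
      (v + ε + ‖q‖ * ‖d‖ * (K * (‖d‖ + C * δ))) * (r' - r) := by
    have hCY := hF.isCaratheodory α β (runSignal t T)
    have hint := hCY.intervalIntegrable htrY.1 hrm hrm'
    rw [htrY.sub_eq_integral hrm hrm', ← (q d).intervalIntegral_comp_comm hint]
    have hmono := intervalIntegral.integral_mono_on_of_le_Ioo hrr'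
      (f := fun x => q d ((runSignal t T).1 x • F (Y x) (α.1 x) (β.1 x)))
      (g := fun _ => v + ε + ‖q‖ * ‖d‖ * (K * (‖d‖ + C * δ)))
      ((q d).integrable_comp hint.1 |> fun h => ⟨h, (q d).integrable_comp hint.2⟩)
      intervalIntegrable_const fun x hx => ?_
    · rw [intervalIntegral.integral_const, smul_eq_mul, mul_comm] at hmono
      exact hmono
    · have hxm : x ∈ Icc t T := ⟨hrm.1.trans hx.1.le, hx.2.le.trans hrm'.2⟩
      have h1 : (runSignal t T).1 x = 1 := rfl
      rw [h1, one_smul]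
      have h2 := (abs_le.1 (hFle _ (α.mem hxm) _ (β.mem hxm) (Y x))).2
      have h3 := hα x ⟨hx.1.le, hx.2⟩
      have h4 : ‖Y x - W s‖ ≤ ‖d‖ + C * δ := by
        have h5 := norm_add_le (Y x - Y r) (Y r - W s)
        rw [sub_add_sub_cancel] at h5
        have h6 := hYL r hrm x hxm hx.1.le
        have h7 : C * (x - r) ≤ C * δ := by gcongr; linarith [hx.2]
        linarith
      have h8 : ‖q‖ * ‖d‖ * (K * ‖Y x - W s‖) ≤ ‖q‖ * ‖d‖ * (K * (‖d‖ + C * δ)) := by gcongr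
      linarith
  -- Freezing scales the guide's velocity by `μ`, whose integral is `r' - r`. So `v` carries the
  -- same factor as for the path and cancels in `hlin`.
  have hQ : (v - ε - ‖q‖ * ‖d‖ * (K * (C * δ))) * (r' - r) ≤ q d (W s' - W s) := by
    have hCW := hF.isCaratheodory α' u μ
    have hint := hCW.intervalIntegrable htrW.1 hs hs'
    rw [htrW.sub_eq_integral hs hs', ← (q d).intervalIntegral_comp_comm hint, hr, hr',
      clock_sub μ hs hs', ← intervalIntegral.integral_const_mul]
    refine intervalIntegral.integral_mono_on_of_le_Ioo hss'
      ((clock_intervalIntegrable μ hs hs').const_mul _)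
      ⟨(q d).integrable_comp hint.1, (q d).integrable_comp hint.2⟩ fun x hx => ?_
    have hxm : x ∈ Icc t T := ⟨hs.1.trans hx.1.le, hx.2.le.trans hs'.2⟩
    rw [map_smul, smul_eq_mul, mul_comm]
    refine mul_le_mul_of_nonneg_left ?_ (μ.mem hxm).1
    have h2 := (abs_le.1 (hFle _ (α'.mem hxm) _ (u.mem hxm) (W x))).1
    have h3 := hu x ⟨hx.1.le, hx.2⟩ _ (α'.mem hxm)
    have h4 : ‖W x - W s‖ ≤ C * δ := by
      refine (hWL s hs x hxm hx.1.le).trans ?_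
      gcongr; linarith [hx.2]
    have h8 : ‖q‖ * ‖d‖ * (K * ‖W x - W s‖) ≤ ‖q‖ * ‖d‖ * (K * (C * δ)) := by gcongr
    linarith
  set D := q d d with hD
  have hdD : ‖d‖ ^ 2 ≤ D := hpos d
  set P := Y r' - Y r with hPdef
  set Q := W s' - W s with hQdef
  have hexp : Y r' - W s' = d + (P - Q) := by rw [hd, hPdef, hQdef]; abel
  have hPQ : ‖P - Q‖ ≤ 2 * C * δ := by
    have h1 := norm_sub_le P Q
    have h2 : ‖P‖ ≤ C * δ := (hYL r hrm r' hrm' hrr').trans (by gcongr)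
    have h3 : ‖Q‖ ≤ C * δ := (hWL s hs s' hs' hss').trans (by gcongr)
    linarith
  have hsq : q (P - Q) (P - Q) ≤ 4 * ‖q‖ * C ^ 2 * δ ^ 2 := by
    refine (le_abs_self _).trans ((hqle _ _).trans ?_)
    calc ‖q‖ * ‖P - Q‖ * ‖P - Q‖ ≤ ‖q‖ * (2 * C * δ) * (2 * C * δ) := by gcongr
      _ = _ := by ring
  have hlin : q d (P - Q) ≤ δ * (2 * ε + ‖q‖ * K * D + 4 * ‖q‖ * K * C ^ 2 * δ) := by
    rw [map_sub]
    have h1 : q d P - q d Q ≤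
        (r' - r) * (2 * ε + ‖q‖ * K * ‖d‖ ^ 2 + 2 * (‖q‖ * K * C * δ * ‖d‖)) := by
      linarith
    refine h1.trans ?_
    have h2 : 2 * ε + ‖q‖ * K * ‖d‖ ^ 2 + 2 * (‖q‖ * K * C * δ * ‖d‖) ≤
        2 * ε + ‖q‖ * K * D + 2 * (‖q‖ * K * C * δ * (2 * C)) := by gcongr
    have h3 : 0 ≤ 2 * ε + ‖q‖ * K * ‖d‖ ^ 2 + 2 * (‖q‖ * K * C * δ * ‖d‖) := by positivity
    calc _ ≤ δ * (2 * ε + ‖q‖ * K * D + 2 * (‖q‖ * K * C * δ * (2 * C))) :=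
          mul_le_mul hm h2 h3 hδ0
      _ = _ := by ring
  rw [hexp]
  have : q (d + (P - Q)) (d + (P - Q)) = D + 2 * q d (P - Q) + q (P - Q) (P - Q) := by
    generalize P - Q = e
    have h1 : q (d + e) = q d + q e := map_add _ _ _
    rw [h1, add_apply, map_add, map_add, hsymm e d]
    ring
  rw [this]
  linarith

end Tracking

section Splice

variable {E : Type*} [NormedAddCommGroup E] {U : Set E} {t T : ℝ}

lemma ControlSignal.splice_agreeOn {hU : Bornology.IsBounded U} {u u' v v' : ControlSignal U t T}
    {r s : ℝ} (hu : AgreeOn t s u.1 u'.1) (hv : AgreeOn t s v.1 v'.1) :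
    AgreeOn t s (ControlSignal.splice hU u v r).1 (ControlSignal.splice hU u' v' r).1 := by
  filter_upwards [hu, hv] with x hx hx'
  rcases lt_or_ge x r with h | h
  · rw [splice_of_lt h, splice_of_lt h, hx]
  · rw [splice_of_le h, splice_of_le h, hx']

lemma ControlSignal.splice_agreeOn_left {hU : Bornology.IsBounded U} {u v : ControlSignal U t T}
    {r s : ℝ} (h : s < r) : AgreeOn t s (ControlSignal.splice hU u v r).1 u.1 :=
  AgreeOn.of_eqOn fun _ hx => splice_of_lt (hx.2.trans_lt h)

end Splice

section Aiming

variable {EA EB X : Type*} [NormedAddCommGroup EA] [NormedAddCommGroup EB]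
  [NormedAddCommGroup X] [NormedSpace ℝ X]
  [MeasurableSpace EA] [MeasurableSpace EB] [MeasurableSpace X]
  [BorelSpace EA] [BorelSpace EB] [BorelSpace X] [SecondCountableTopology EA]
  {A : Set EA} {B : Set EB} {F : X → EA → EB → X} {K : ℝ≥0} {M : ℝ} {t T : ℝ}

/-- Extremal aiming with a guide. At the guide's times `s k`, a control and a counter-control are
selected from the position of the guide and the displacement of the path; the guide's opponent uses
the former, the path uses the latter from the corresponding running time on. The first component
is the signal fed to the guide, the second one the signal steering the path. -/
noncomputable def aim (F : X → EA → EB → X) (y₀ : X) (hA : Bornology.IsBounded A)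
    (hB : Bornology.IsBounded B) (hB₀ : B.Nonempty) (e : X → X → B × Selector A B)
    (γ : Strategy B A t T) (ν : Strategy B freezeSet t T) (s : ℕ → ℝ) (β : ControlSignal B t T) :
    ℕ → ControlSignal B t T × ControlSignal A t T
  -- Placeholders: when `s 0 = t`, stage 1 overwrites both signals on all of `[t, T]`.
  | 0 => (ControlSignal.const (e 0 0).1, (e 0 0).2.respond hA hB₀ β)
  | k + 1 =>
    let p := aim F y₀ hA hB hB₀ e γ ν s β k
    let w := flow F t T y₀ (γ.1 p.1).1 p.1.1 (ν.1 p.1).1 (s k)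
    -- Stage `k` already fixes the guide's input up to `s k`, hence its clock there. The switching
    -- time `r` therefore needs only observations of `β` made before it.
    let r := clock t (ν.1 p.1).1 (s k)
    let y := flow F t T y₀ p.2.1 β.1 (runSignal t T).1 r
    (ControlSignal.splice hB p.1 (ControlSignal.const (e w (y - w)).1) (s k),
      ControlSignal.splice hA p.2 ((e w (y - w)).2.respond hA hB₀ β) r)

variable [SecondCountableTopology X] [CompleteSpace X]
  {y₀ : X} {hA : Bornology.IsBounded A} {hB : Bornology.IsBounded B} {hB₀ : B.Nonempty}
  {e : X → X → B × Selector A B} {γ : Strategy B A t T} {ν : Strategy B freezeSet t T} {s : ℕ → ℝ}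
  {β : ControlSignal B t T}

local notation "aimed" => aim F y₀ hA hB hB₀ e γ ν s

omit [SecondCountableTopology X] [CompleteSpace X] [MeasurableSpace X] [BorelSpace X] in
lemma guide_apply_of_lt (hs : Monotone s) {k j : ℕ} (hkj : k ≤ j) {x : ℝ} (hx : x < s k) :
    (aimed β j).1.1 x = (aimed β k).1.1 x := by
  induction j, hkj using Nat.le_induction with
  | base => rfl
  | succ j hj ih =>
    refine Eq.trans ?_ ih
    exact ControlSignal.splice_of_lt (hU := hB) (hx.trans_le (hs hj))

omit [SecondCountableTopology X] [CompleteSpace X] [MeasurableSpace X] [BorelSpace X] in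
lemma guide_agreeOn (hs : Monotone s) {k j : ℕ} (hkj : k ≤ j) :
    AgreeOn t (s k) (aimed β j).1.1 (aimed β k).1.1 :=
  AgreeOn.of_eqOn_Ico fun _ hx => guide_apply_of_lt hs hkj hx.2

-- Later stages alter the guide's input only after `s k`, so by non-anticipativity of `ν` the
-- running time of this node is settled at stage `k`.
omit [SecondCountableTopology X] [CompleteSpace X] [MeasurableSpace X] [BorelSpace X] in
lemma clock_guide (hs : Monotone s) (hsm : ∀ k, s k ∈ Icc t T) {k j : ℕ} (hkj : k ≤ j) :
    clock t (ν.1 (aimed β j).1).1 (s k) = clock t (ν.1 (aimed β k).1).1 (s k) :=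
  clock_congr (ν.2 _ (hsm k) _ _ (guide_agreeOn hs hkj)) ⟨(hsm k).1, le_rfl⟩

omit [SecondCountableTopology X] [CompleteSpace X] [MeasurableSpace X] [BorelSpace X] in
lemma runTime_monotone (hs : Monotone s) (hsm : ∀ k, s k ∈ Icc t T) :
    Monotone (fun k => clock t (ν.1 (aimed β k).1).1 (s k)) := by
  refine monotone_nat_of_le_succ fun k => ?_
  have h1 := clock_guide (F := F) (y₀ := y₀) (hA := hA) (hB := hB) (hB₀ := hB₀) (e := e) (γ := γ)
    (ν := ν) (β := β) hs hsm (Nat.le_succ k)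
  rw [← h1]
  exact clock_mono _ (hsm _) (hsm _) (hs (Nat.le_succ k))

omit [SecondCountableTopology X] [CompleteSpace X] [MeasurableSpace X] [BorelSpace X] in
lemma steer_apply_of_lt (hs : Monotone s) (hsm : ∀ k, s k ∈ Icc t T) {k j : ℕ} (hkj : k ≤ j)
    {x : ℝ} (hx : x < clock t (ν.1 (aimed β k).1).1 (s k)) :
    (aimed β j).2.1 x = (aimed β k).2.1 x := by
  induction j, hkj using Nat.le_induction with
  | base => rfl
  | succ j hj ih =>
    refine Eq.trans ?_ ih
    exact ControlSignal.splice_of_lt (hU := hA) (hx.trans_le (runTime_monotone hs hsm hj))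

/-- Extremal aiming keeps the path close to the guide. -/
lemma IsGameField.aim_tracking (hF : IsGameField A B F K M)
    (q : X →L[ℝ] X →L[ℝ] ℝ) (hsymm : ∀ x y, q x y = q y x) (hpos : ∀ x, ‖x‖ ^ 2 ≤ q x x)
    {C δ ε : ℝ} (hC0 : 0 ≤ C)
    (hC : ∀ (α : ControlSignal A t T) (β : ControlSignal B t T) (μ : ControlSignal freezeSet t T),
      (∀ s ∈ Icc t T, ‖flow F t T y₀ α.1 β.1 μ.1 s‖ ≤ C) ∧
      (∀ r ∈ Icc t T, ∀ s ∈ Icc t T, r ≤ s →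
        ‖flow F t T y₀ α.1 β.1 μ.1 s - flow F t T y₀ α.1 β.1 μ.1 r‖ ≤ C * (s - r)))
    (hε : 0 ≤ ε)
    (he : ∀ w d, ∃ v, (∀ b : B, q d (F w ((e w d).2.1 b) b) ≤ v + ε) ∧
      ∀ a ∈ A, v ≤ q d (F w a (e w d).1) + ε)
    (hs : Monotone s) (hsm : ∀ k, s k ∈ Icc t T) (hs0 : s 0 = t) (hδ : ∀ k, s (k + 1) - s k ≤ δ)
    (j : ℕ) {k : ℕ} (hkj : k ≤ j) (Y W : ℝ → X)
    (hY : Y = flow F t T y₀ (aimed β j).2.1 β.1 (runSignal t T).1)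
    (hW : W = flow F t T y₀ (γ.1 (aimed β j).1).1 (aimed β j).1.1 (ν.1 (aimed β j).1).1) :
    q (Y (clock t (ν.1 (aimed β j).1).1 (s k)) - W (s k))
      (Y (clock t (ν.1 (aimed β j).1).1 (s k)) - W (s k)) ≤
      k * (δ * (4 * ε + (8 * ‖q‖ * K * C ^ 2 + 4 * ‖q‖ * C ^ 2) * δ)) *
        Real.exp (k * (2 * ‖q‖ * K * δ)) := by
  have htT : t ≤ T := (hsm 0).1.trans (hsm 0).2
  have hδ0 : 0 ≤ δ := (sub_nonneg.2 (hs (Nat.le_succ 0))).trans (hδ 0)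
  -- Discrete Gronwall: squared distances satisfy `D (k + 1) ≤ (1 + l) * D k + η` with `D 0 = 0`,
  -- where `η` and `l` come from `tracking_step`.
  induction k with
  | zero =>
    have h1 : Y (clock t (ν.1 (aimed β j).1).1 (s 0)) - W (s 0) = 0 := by
      rw [hs0, clock_start, hY, hW, hF.flow_initial htT, hF.flow_initial htT, sub_self]
    simp [h1]
  | succ k ih =>
    have hk : k ≤ j := (Nat.le_succ k).trans hkj
    specialize ih hk
    set η := δ * (4 * ε + (8 * ‖q‖ * K * C ^ 2 + 4 * ‖q‖ * C ^ 2) * δ) with hη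
    set l := 2 * ‖q‖ * K * δ with hl
    have hη0 : 0 ≤ η := by positivity
    have hl0 : 0 ≤ l := by positivity
    have hr : clock t (ν.1 (aimed β j).1).1 (s k) = clock t (ν.1 (aimed β k).1).1 (s k) :=
      clock_guide hs hsm hk
    have hr' : clock t (ν.1 (aimed β j).1).1 (s (k + 1)) =
        clock t (ν.1 (aimed β (k + 1)).1).1 (s (k + 1)) :=
      clock_guide hs hsm hkj
    have hrm : clock t (ν.1 (aimed β k).1).1 (s k) ∈ Icc t T := clock_mem _ (hsm k)
    have hWk : W (s k) = flow F t T y₀ (γ.1 (aimed β k).1).1 (aimed β k).1.1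
        (ν.1 (aimed β k).1).1 (s k) := by
      have hag : AgreeOn t (s k) (aimed β j).1.1 (aimed β k).1.1 := guide_agreeOn hs hk
      rw [hW]
      exact hF.flow_eqOn htT y₀ (hsm k).2 (γ.2 _ (hsm k) _ _ hag) hag (ν.2 _ (hsm k) _ _ hag)
        ⟨(hsm k).1, le_rfl⟩
    have hYk : Y (clock t (ν.1 (aimed β k).1).1 (s k)) = flow F t T y₀ (aimed β k).2.1 β.1
        (runSignal t T).1 (clock t (ν.1 (aimed β k).1).1 (s k)) := by
      rw [hY]
      exact hF.flow_eqOn htT y₀ hrm.2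
        (AgreeOn.of_eqOn_Ico fun x hx => steer_apply_of_lt hs hsm hk hx.2)
        (AgreeOn.refl _ _) (AgreeOn.refl _ _) ⟨hrm.1, le_rfl⟩
    set w := W (s k) with hw
    set d := Y (clock t (ν.1 (aimed β j).1).1 (s k)) - w with hd
    have hd' : d = flow F t T y₀ (aimed β k).2.1 β.1 (runSignal t T).1
        (clock t (ν.1 (aimed β k).1).1 (s k)) - w := by
      rw [hd, hr, hYk]
    obtain ⟨v, hv1, hv2⟩ := he w d
    have hguide : ∀ x ∈ Ico (s k) (s (k + 1)), (aimed β j).1.1 x = (e w d).1 := by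
      intro x hx
      refine (guide_apply_of_lt hs hkj hx.2).trans ?_
      refine (ControlSignal.splice_of_le (hU := hB) hx.1).trans ?_
      rw [hd', hWk]
      rfl
    have hsteer : ∀ x ∈ Ico (clock t (ν.1 (aimed β k).1).1 (s k))
        (clock t (ν.1 (aimed β (k + 1)).1).1 (s (k + 1))),
        (aimed β j).2.1 x = ((e w d).2.respond hA hB₀ β).1 x := by
      intro x hx
      refine (steer_apply_of_lt hs hsm hkj hx.2).trans ?_
      refine (ControlSignal.splice_of_le (hU := hA) hx.1).trans ?_
      rw [hd', hWk]
    have hstep := hF.tracking_step y₀ q hsymm hpos (μ := ν.1 (aimed β j).1) (v := v) (δ := δ)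
      (s := s k) (s' := s (k + 1)) hY hW hC0
      (hY ▸ (hC _ _ _).1) (hW ▸ (hC _ _ _).1) (hY ▸ (hC _ _ _).2) (hW ▸ (hC _ _ _).2)
      hε (hsm k) (hsm (k + 1)) (hs (Nat.le_succ k)) (hδ k) ?_ ?_
    · refine hstep.trans ?_
      have hexp : 1 + l ≤ Real.exp l := by linarith [Real.add_one_le_exp l]
      have h1 : 0 ≤ k * η * Real.exp (k * l) := by positivity
      calc (1 + l) * q d d + η ≤ Real.exp l * (k * η * Real.exp (k * l)) + η := by
            have h2 : 0 ≤ q d d := (sq_nonneg _).trans (hpos d)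
            gcongr
        _ = k * η * Real.exp ((k + 1) * l) + η * 1 := by
            rw [add_mul, one_mul, Real.exp_add]; ring
        _ ≤ k * η * Real.exp ((k + 1) * l) + η * Real.exp ((k + 1) * l) := by
            gcongr
            exact Real.one_le_exp (by positivity)
        _ = _ := by push_cast; ring
    · intro x hx
      rw [hr, hr'] at hx
      have hxm : x ∈ Icc t T := ⟨hrm.1.trans hx.1, hx.2.le.trans (clock_mem _ (hsm (k + 1))).2⟩
      rw [hsteer x hx, Selector.respond_apply hxm]
      exact hv1 ⟨β.1 x, β.mem hxm⟩
    · intro x hx a ha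
      rw [hguide x hx]
      exact hv2 a ha

/-- Extremal aiming is non-anticipative. -/
lemma IsGameField.aim_nonanticipative (hF : IsGameField A B F K M)
    (hs : Monotone s) (hsm : ∀ k, s k ∈ Icc t T) {β β' : ControlSignal B t T} {x : ℝ}
    (hx : x ∈ Icc t T) (hβ : AgreeOn t x β.1 β'.1) (k : ℕ) :
    AgreeOn t x (aimed β k).2.1 (aimed β' k).2.1 ∧
      ((aimed β k).1 = (aimed β' k).1 ∨ (x < clock t (ν.1 (aimed β k).1).1 (s k) ∧
        x < clock t (ν.1 (aimed β' k).1).1 (s k))) := by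
  have htT : t ≤ T := (hsm 0).1.trans (hsm 0).2
  induction k with
  | zero => exact ⟨Selector.respond_agreeOn (hA := hA) hβ, Or.inl rfl⟩
  | succ k ih =>
    obtain ⟨ih1, ih2⟩ := ih
    -- The invariant: either the guides of the two inputs are the same signal so far, or both runs
    -- have node `k` at a running time after `x`. In the latter case all further splices of the
    -- steering signals lie beyond `x`.
    have hlate : x < clock t (ν.1 (aimed β k).1).1 (s k) →
        x < clock t (ν.1 (aimed β' k).1).1 (s k) →
        AgreeOn t x (aimed β (k + 1)).2.1 (aimed β' (k + 1)).2.1 ∧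
        ((aimed β (k + 1)).1 = (aimed β' (k + 1)).1 ∨
          (x < clock t (ν.1 (aimed β (k + 1)).1).1 (s (k + 1)) ∧
            x < clock t (ν.1 (aimed β' (k + 1)).1).1 (s (k + 1)))) := fun h h' =>
      ⟨((ControlSignal.splice_agreeOn_left (hU := hA) h).trans ih1).trans
        (ControlSignal.splice_agreeOn_left (hU := hA) h').symm,
        Or.inr ⟨h.trans_le (runTime_monotone hs hsm (Nat.le_succ k)),
          h'.trans_le (runTime_monotone hs hsm (Nat.le_succ k))⟩⟩
    rcases ih2 with hg | ⟨h, h'⟩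
    swap
    · exact hlate h h'
    have hrr : clock t (ν.1 (aimed β k).1).1 (s k) = clock t (ν.1 (aimed β' k).1).1 (s k) := by
      rw [hg]
    rcases lt_or_ge x (clock t (ν.1 (aimed β k).1).1 (s k)) with h | h
    · exact hlate h (hrr ▸ h)
    have hrm : clock t (ν.1 (aimed β k).1).1 (s k) ∈ Icc t T := clock_mem _ (hsm k)
    have hy : flow F t T y₀ (aimed β k).2.1 β.1 (runSignal t T).1
          (clock t (ν.1 (aimed β k).1).1 (s k)) =
        flow F t T y₀ (aimed β' k).2.1 β'.1 (runSignal t T).1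
          (clock t (ν.1 (aimed β k).1).1 (s k)) :=
      hF.flow_eqOn htT y₀ hx.2 ih1 hβ (AgreeOn.refl _ _) ⟨hrm.1, h⟩
    refine ⟨?_, Or.inl ?_⟩
    · simp only [aim]
      rw [hy, ← hg]
      exact ControlSignal.splice_agreeOn ih1 (Selector.respond_agreeOn hβ)
    · simp only [aim]
      rw [hy, ← hg]

end Aiming

section Aiming

variable {EA EB X : Type*} [NormedAddCommGroup EA] [NormedAddCommGroup EB]
  [NormedAddCommGroup X] [NormedSpace ℝ X]
  [MeasurableSpace EA] [MeasurableSpace EB] [MeasurableSpace X]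
  [BorelSpace EA] [BorelSpace EB] [BorelSpace X] [SecondCountableTopology EA]
  [SecondCountableTopology X] [CompleteSpace X]
  {A : Set EA} {B : Set EB} {F : X → EA → EB → X} {K : ℝ≥0} {M : ℝ} {t T : ℝ}

/-- Paths of the game can be steered arbitrarily close to a frozen guide, whatever the strategies
of the guide are. -/
lemma IsGameField.exists_strategy_tracking (hF : IsGameField A B F K M) (htT : t ≤ T) (y₀ : X)
    (q : X →L[ℝ] X →L[ℝ] ℝ) (hsymm : ∀ x y, q x y = q y x) (hpos : ∀ x, ‖x‖ ^ 2 ≤ q x x)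
    (γ : Strategy B A t T) (ν : Strategy B freezeSet t T) {e : ℝ} (he : 0 < e) :
    ∃ γ' : Strategy B A t T, ∀ β : ControlSignal B t T, ∃ u : ControlSignal B t T,
      ∀ p ∈ Icc t T, ‖flow F t T y₀ (γ'.1 β).1 β.1 (runSignal t T).1 (clock t (ν.1 u).1 p) -
        flow F t T y₀ (γ.1 u).1 u.1 (ν.1 u).1 p‖ ≤ e := by
  obtain ⟨C, hC0, hC⟩ := hF.exists_bound t T y₀
  set c₀ := 8 * ‖q‖ * K * C ^ 2 + 4 * ‖q‖ * C ^ 2 with hc₀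
  set l := 2 * ‖q‖ * K with hl
  -- `Θ` bounds `k * δ` for all nodes used, as rounding up the number of steps costs at most `δ ≤
  -- 1`. With selection error `ε = δ`, the squared distance at the nodes is then at most `G * δ`.
  set Θ := T - t + 1 with hΘ
  have hΘ0 : 0 ≤ Θ := by linarith
  have hc₀0 : 0 ≤ c₀ := by positivity
  have hl0 : 0 ≤ l := by positivity
  set G := Θ * (4 + c₀) * Real.exp (Θ * l) with hG
  -- The root is the distance at the nodes; `2 * C * δ` is what path and guide can move between
  -- nodes.
  obtain ⟨δ, hδ0, hδ1, hδe⟩ : ∃ δ : ℝ, 0 < δ ∧ δ ≤ 1 ∧ 2 * C * δ + Real.sqrt (G * δ) ≤ e := by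
    have hcont : Continuous fun δ : ℝ => 2 * C * δ + Real.sqrt (G * δ) := by fun_prop
    have hlim := (hcont.tendsto 0).mono_left (nhdsWithin_le_nhds (s := Ioi (0 : ℝ)))
    simp only [mul_zero, Real.sqrt_zero, add_zero] at hlim
    have h1 := hlim.eventually (eventually_lt_nhds he)
    have h2 : ∀ᶠ δ : ℝ in nhdsWithin 0 (Ioi 0), δ ∈ Ioc (0 : ℝ) 1 := Ioc_mem_nhdsGT one_pos
    obtain ⟨δ, hδ, hδm⟩ := (h1.and h2).exists
    exact ⟨δ, hδm.1, hδm.2, hδ.le⟩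
  choose b φ v hv1 hv2 using fun w d => hF.exists_saddle w (q d) hδ0
  let E : X → X → B × Selector A B := fun w d => (b w d, φ w d)
  let s : ℕ → ℝ := fun k => min T (t + k * δ)
  have hs : Monotone s := fun i j hij => by
    simp only [s]
    gcongr
  have hsm : ∀ k, s k ∈ Icc t T := fun k => ⟨le_min htT (by
    have : 0 ≤ k * δ := by positivity
    linarith), min_le_left _ _⟩
  have hs0 : s 0 = t := by simp [s, htT]
  have hsδ : ∀ k, s (k + 1) - s k ≤ δ := by
    intro k
    simp only [s]
    push_cast
    rcases le_total T (t + k * δ) with h | h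
    · rw [min_eq_left h]
      linarith [min_le_left T (t + (k + 1) * δ)]
    · rw [min_eq_right h]
      linarith [min_le_right T (t + (k + 1) * δ)]
  set N := ⌈(T - t) / δ⌉₊ with hN
  have hNδ : N * δ ≤ Θ := by
    have h1 := (Nat.ceil_lt_add_one (div_nonneg (sub_nonneg.2 htT) hδ0.le)).le
    have h2 : (N : ℝ) * δ ≤ ((T - t) / δ + 1) * δ := by gcongr
    rw [add_mul, div_mul_cancel₀ _ hδ0.ne'] at h2
    linarith
  have hA := hF.isCompact_left.isBounded
  have hB := hF.isCompact_right.isBounded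
  let Z := aim F y₀ hA hB hF.nonempty_right E γ ν s
  refine ⟨⟨fun β => (Z β N).2, fun x hx β β' hβ =>
    (hF.aim_nonanticipative hs hsm hx hβ N).1⟩, fun β => ⟨(Z β N).1, fun p hp => ?_⟩⟩
  set σ := clock t (ν.1 (Z β N).1).1 with hσ
  set Y := flow F t T y₀ (Z β N).2.1 β.1 (runSignal t T).1 with hY
  set W := flow F t T y₀ (γ.1 (Z β N).1).1 (Z β N).1.1 (ν.1 (Z β N).1).1 with hW
  change ‖Y (σ p) - W p‖ ≤ e
  have hclose : ∀ k ≤ N, ‖Y (σ (s k)) - W (s k)‖ ≤ Real.sqrt (G * δ) := by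
    intro k hk
    have h1 := hF.aim_tracking q hsymm hpos hC0
      hC hδ0.le (e := E) (fun w d => ⟨v w d, hv1 w d, hv2 w d⟩) hs hsm hs0 hsδ N hk Y W hY hW
    refine Real.le_sqrt_of_sq_le ((hpos _).trans (h1.trans ?_))
    have hkδ : (k : ℝ) * δ ≤ Θ := le_trans (by gcongr) hNδ
    calc (k : ℝ) * (δ * (4 * δ + c₀ * δ)) * Real.exp (k * (l * δ))
        = (k * δ) * (4 + c₀) * Real.exp ((k * δ) * l) * δ := by ring_nf
      _ ≤ Θ * (4 + c₀) * Real.exp (Θ * l) * δ := by gcongr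
  set k := ⌊(p - t) / δ⌋₊ with hk
  have hpt : 0 ≤ (p - t) / δ := div_nonneg (sub_nonneg.2 hp.1) hδ0.le
  have hkp : k * δ ≤ p - t := by
    have := Nat.floor_le hpt
    rwa [le_div_iff₀ hδ0] at this
  have hkp' : p - t ≤ (k + 1) * δ := by
    have := (Nat.lt_floor_add_one ((p - t) / δ)).le
    rwa [div_le_iff₀ hδ0] at this
  have hkN : k ≤ N := by
    refine (Nat.floor_le_floor ?_).trans (Nat.floor_le_ceil ((T - t) / δ))
    gcongr
    exact hp.2
  have hsk : s k = t + k * δ := min_eq_right (by linarith [hp.2])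
  have hsp : s k ≤ p := by linarith
  have hps : p - s k ≤ δ := by linarith
  have h1 : ‖Y (σ p) - Y (σ (s k))‖ ≤ C * δ := by
    refine ((hC (Z β N).2 β (runSignal t T)).2 _ (clock_mem _ (hsm k)) _ (clock_mem _ hp)
      (clock_mono _ (hsm k) hp hsp)).trans ?_
    gcongr
    exact (clock_sub_le _ (hsm k) hp hsp).trans hps
  have h2 : ‖W p - W (s k)‖ ≤ C * δ := by
    refine ((hC (γ.1 (Z β N).1) (Z β N).1 (ν.1 (Z β N).1)).2 _ (hsm k) _ hp hsp).trans ?_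
    gcongr
  have h3 : Y (σ p) - W p =
      (Y (σ p) - Y (σ (s k))) + (Y (σ (s k)) - W (s k)) - (W p - W (s k)) := by
    abel
  rw [h3]
  have h4 := norm_sub_le ((Y (σ p) - Y (σ (s k))) + (Y (σ (s k)) - W (s k))) (W p - W (s k))
  have h5 := norm_add_le (Y (σ p) - Y (σ (s k))) (Y (σ (s k)) - W (s k))
  linarith [hclose k hkN]

/-- The power of choosing a terminal time gives the minimizer at least the power of freezing
controls. -/
lemma IsGameField.iInf_strategy_le (hF : IsGameField A B F K M) {c h : X → ℝ} {Kc Kh : ℝ≥0}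
    (hc : LipschitzWith Kc c) (hh : LipschitzWith Kh h) (htT : t ≤ T) (y₀ : X)
    (q : X →L[ℝ] X →L[ℝ] ℝ) (hsymm : ∀ x y, q x y = q y x) (hpos : ∀ x, ‖x‖ ^ 2 ≤ q x x) :
    (⨅ γ : Strategy B A t T, ⨆ β : ControlSignal B t T, ⨅ τ ∈ Icc t T,
        stopCost c h t (flow F t T y₀ (γ.1 β).1 β.1 (runSignal t T).1) τ) ≤
      ⨅ (γ : Strategy B A t T) (ν : Strategy B freezeSet t T), ⨆ β : ControlSignal B t T,
        stopCost c h t (flow F t T y₀ (γ.1 β).1 β.1 (ν.1 β).1) T := by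
  refine le_iInf₂ fun γ ν => ?_
  rw [← EReal.le_of_forall_lt_iff_le]
  intro v hv
  obtain ⟨v', hv', hv'v⟩ := EReal.exists_between_coe_real hv
  rw [EReal.coe_lt_coe_iff] at hv'v
  have hpos' : 0 < (Kc : ℝ) + Kh + 1 := by positivity
  -- A displacement of `e` changes either cost by at most `v - v'`; the 1 keeps the denominator
  -- positive.
  set e := (v - v') / (Kc + Kh + 1) with he
  have he0 : 0 < e := div_pos (sub_pos.2 hv'v) hpos'
  have hev : (Kc + Kh + 1) * e = v - v' := mul_div_cancel₀ _ hpos'.ne'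
  have hce : Kc * e ≤ v - v' := by
    rw [← hev]; gcongr; linarith [Kh.2]
  have hhe : Kh * e ≤ v - v' := by
    rw [← hev]; gcongr; linarith [Kc.2]
  obtain ⟨γ', hγ'⟩ := hF.exists_strategy_tracking htT y₀ q hsymm hpos γ ν he0
  refine iInf_le_of_le γ' (iSup_le fun β => ?_)
  obtain ⟨u, hu⟩ := hγ' β
  have hT := right_mem_Icc.2 htT
  have hcost := stopCost_le_coe_iff.1 ((le_iSup (fun β : ControlSignal B t T =>
    stopCost c h t (flow F t T y₀ (γ.1 β).1 β.1 (ν.1 β).1) T) u).trans hv'.le)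
  have hlip : ∀ {g : X → ℝ} {L : ℝ≥0}, LipschitzWith L g → L * e ≤ v - v' → ∀ {x y : X},
      ‖x - y‖ ≤ e → g y ≤ v' → g x ≤ v := by
    intro g L hg hL x y hxy hy
    have h1 := hg.dist_le_mul x y
    rw [dist_eq_norm, dist_eq_norm] at h1
    have h2 : L * ‖x - y‖ ≤ L * e := by gcongr
    have h3 := le_abs_self (g x - g y)
    rw [← Real.norm_eq_abs] at h3
    linarith
  -- Stop the path when the guide's clock ends. The clock maps `[t, T]` onto the running interval,
  -- so every point of the path up to then has a guide point within `e`.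
  refine iInf₂_le_of_le (clock t (ν.1 u).1 T) (clock_mem _ hT) (stopCost_le_coe_iff.2 ⟨?_, ?_⟩)
  · intro x hx
    rw [← clock_image _ hT] at hx
    obtain ⟨p, hp, rfl⟩ := hx
    exact hlip hc hce (hu p hp) (hcost.1 p hp)
  · exact hlip hh hhe (hu T hT) hcost.2

end Aiming

/-! ### The state augmented by the budget, and conclusion -/

section Augmented

variable {n ma mb : ℕ}

/-- The vector field `(f, -L)` of the state augmented by the remaining budget. -/
def augmentedField
    (f : EuclideanSpace ℝ (Fin n) → EuclideanSpace ℝ (Fin ma) → EuclideanSpace ℝ (Fin mb) →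
      EuclideanSpace ℝ (Fin n))
    (L : EuclideanSpace ℝ (Fin n) → EuclideanSpace ℝ (Fin ma) → EuclideanSpace ℝ (Fin mb) → ℝ) :
    EuclideanSpace ℝ (Fin n) × ℝ → EuclideanSpace ℝ (Fin ma) → EuclideanSpace ℝ (Fin mb) →
      EuclideanSpace ℝ (Fin n) × ℝ :=
  fun y a b => (f y.1 a b, -L y.1 a b)

variable {A : Set (EuclideanSpace ℝ (Fin ma))} {B : Set (EuclideanSpace ℝ (Fin mb))}
  {f : EuclideanSpace ℝ (Fin n) → EuclideanSpace ℝ (Fin ma) → EuclideanSpace ℝ (Fin mb) →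
    EuclideanSpace ℝ (Fin n)}
  {L : EuclideanSpace ℝ (Fin n) → EuclideanSpace ℝ (Fin ma) → EuclideanSpace ℝ (Fin mb) → ℝ}

lemma exists_isGameField_augmentedField
    (hA : IsCompact A) (hB : IsCompact B) (hA₀ : A.Nonempty) (hB₀ : B.Nonempty)
    (hf_meas : ∀ x, Measurable (fun p : A × B => f x p.1 p.2))
    (hL_meas : ∀ x, Measurable (fun p : A × B => L x p.1 p.2))
    (hf_lip : ∃ K : ℝ≥0, ∀ a ∈ A, ∀ b ∈ B, LipschitzWith K (fun x => f x a b))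
    (hL_lip : ∃ K : ℝ≥0, ∀ a ∈ A, ∀ b ∈ B, LipschitzWith K (fun x => L x a b))
    (hf_im : IsCompact (Set.image2 (f 0) A B)) (hL_im : IsCompact (Set.image2 (L 0) A B)) :
    ∃ K M, IsGameField A B (augmentedField f L) K M := by
  obtain ⟨Kf, hKf⟩ := hf_lip
  obtain ⟨KL, hKL⟩ := hL_lip
  obtain ⟨Mf, hMf⟩ := hf_im.isBounded.exists_norm_le
  obtain ⟨ML, hML⟩ := hL_im.isBounded.exists_norm_le
  refine ⟨max (Kf * 1) (KL * 1), max Mf ML, hA, hB, hA₀, hB₀, fun y => ?_, fun a ha b hb => ?_,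
    fun a ha b hb => ?_⟩
  · exact (hf_meas y.1).prodMk (hL_meas y.1).neg
  · exact ((hKf a ha b hb).comp LipschitzWith.prod_fst).prodMk
      ((hKL a ha b hb).comp LipschitzWith.prod_fst).neg
  · change ‖(f 0 a b, -L 0 a b)‖ ≤ _
    rw [Prod.norm_mk, norm_neg]
    exact max_le_max (hMf _ (mem_image2_of_mem ha hb)) (hML _ (mem_image2_of_mem ha hb))

/-- The free-terminal-time cost in terms of the augmented flow at unit speed. -/
lemma costJ2_eq_iInf_stopCost {K : ℝ≥0} {M : ℝ} (hF : IsGameField A B (augmentedField f L) K M)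
    (hf_lip : ∃ K : ℝ≥0, ∀ a ∈ A, ∀ b ∈ B, LipschitzWith K (fun x => f x a b))
    (g c : EuclideanSpace ℝ (Fin n) → ℝ) {t T : ℝ} (htT : t ≤ T)
    (x : EuclideanSpace ℝ (Fin n)) (z : ℝ) (α : ControlSignal A t T) (β : ControlSignal B t T) :
    costJ2 (fun _ => f) (fun _ => L) (fun _ => g) (fun _ => c) t T x z α.1 β.1 =
      ⨅ τ ∈ Icc t T, stopCost (fun y => c y.1) (fun y => g y.1 - y.2) t
        (flow (augmentedField f L) t T (x, z) α.1 β.1 (runSignal t T).1) τ := by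
  obtain ⟨Kf, hKf⟩ := hf_lip
  have htr := hF.isTrajectory_flow htT (x, z) α β (runSignal t T)
  set Y := flow (augmentedField f L) t T (x, z) α.1 β.1 (runSignal t T).1 with hY
  have hrun : (fun s => (runSignal t T).1 s • augmentedField f L (Y s) (α.1 s) (β.1 s)) =
      fun s => (f (Y s).1 (α.1 s) (β.1 s), -L (Y s).1 (α.1 s) (β.1 s)) := by
    funext s
    have h1 : (runSignal t T).1 s = 1 := rfl
    rw [h1, one_smul]
    rfl
  obtain ⟨hcont, hint, hval⟩ := htr
  simp only [hrun] at hint hval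
  have hintτ : ∀ τ ∈ Icc t T, IntervalIntegrable
      (fun s => (f (Y s).1 (α.1 s) (β.1 s), -L (Y s).1 (α.1 s) (β.1 s))) volume t τ := fun τ hτ =>
    hint.mono_set (by
      rw [uIcc_of_le hτ.1, uIcc_of_le htT]; exact Icc_subset_Icc_right hτ.2)
  have hfst : IsTrajectory (fun s x => f x (α.1 s) (β.1 s)) t T x (fun s => (Y s).1) := by
    refine ⟨continuous_fst.comp_continuousOn hcont, ⟨hint.1.fst, hint.2.fst⟩, fun s hs => ?_⟩
    have h2 := (ContinuousLinearMap.fst ℝ (EuclideanSpace ℝ (Fin n)) ℝ).intervalIntegral_comp_comm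
      (hintτ s hs)
    simp only [ContinuousLinearMap.coe_fst'] at h2
    rw [h2]
    exact congrArg Prod.fst (hval s hs)
  -- Both paths are solutions of the same Lipschitz equation, so the chosen state trajectory must be
  -- the first component of the augmented flow.
  have hstate : EqOn (stateTraj (fun _ => f) t T x α.1 β.1) (fun s => (Y s).1) (Icc t T) :=
    IsTrajectory.eqOn (fun s hs => hKf _ (α.mem hs) _ (β.mem hs))
      (Classical.epsilon_spec ⟨_, hfst⟩) hfst le_rfl (Filter.Eventually.of_forall fun _ => rfl)
  have hsnd : ∀ τ ∈ Icc t T, (Y τ).2 = z - ∫ s in t..τ, L (Y s).1 (α.1 s) (β.1 s) := by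
    intro τ hτ
    have h2 := (ContinuousLinearMap.snd ℝ (EuclideanSpace ℝ (Fin n)) ℝ).intervalIntegral_comp_comm
      (hintτ τ hτ)
    simp only [ContinuousLinearMap.coe_snd'] at h2
    rw [hval τ hτ, sub_eq_add_neg, ← intervalIntegral.integral_neg, h2]
    rfl
  unfold costJ2 stopCost
  refine biInf_congr fun τ hτ => ?_
  congr 1
  · exact biSup_congr fun s hs => by rw [hstate ⟨hs.1, hs.2.trans hτ.2⟩]
  · have h3 : ∫ s in t..τ, L (stateTraj (fun _ => f) t T x α.1 β.1 s) (α.1 s) (β.1 s) =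
        ∫ s in t..τ, L (Y s).1 (α.1 s) (β.1 s) := by
      refine intervalIntegral.integral_congr fun s hs => ?_
      rw [uIcc_of_le hτ.1] at hs
      simp only [hstate ⟨hs.1, hs.2.trans hτ.2⟩]
    rw [h3, hstate hτ, EReal.coe_eq_coe_iff]
    simp only [hsnd τ hτ]
    ring

/-- The fixed-terminal-time cost in terms of the augmented flow. -/
lemma costJtilde_eq_stopCost (g c : EuclideanSpace ℝ (Fin n) → ℝ) (t T : ℝ)
    (x : EuclideanSpace ℝ (Fin n)) (z : ℝ) (α : ℝ → EuclideanSpace ℝ (Fin ma))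
    (β : ℝ → EuclideanSpace ℝ (Fin mb)) (μ : ℝ → ℝ) :
    costJtilde f L g c t T x z α β μ =
      stopCost (fun y => c y.1) (fun y => g y.1 - y.2) t
        (flow (augmentedField f L) t T (x, z) α β μ) T := rfl

/-- The Euclidean inner product of the augmented state space. -/
noncomputable def augmentedInner (E : Type*) [NormedAddCommGroup E] [InnerProductSpace ℝ E] :
    E × ℝ →L[ℝ] E × ℝ →L[ℝ] ℝ :=
  ((innerₗ E).mkContinuous₂ 1 fun x y => by
      simpa using norm_inner_le_norm (𝕜 := ℝ) x y).bilinearComp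
      (ContinuousLinearMap.fst ℝ E ℝ) (ContinuousLinearMap.fst ℝ E ℝ) +
    (ContinuousLinearMap.mul ℝ ℝ).bilinearComp (ContinuousLinearMap.snd ℝ E ℝ)
      (ContinuousLinearMap.snd ℝ E ℝ)

lemma augmentedInner_apply {E : Type*} [NormedAddCommGroup E] [InnerProductSpace ℝ E]
    (x y : E × ℝ) : augmentedInner E x y = inner ℝ x.1 y.1 + x.2 * y.2 := rfl

/-- The product carries the sup norm, which is not Hilbertian. Extremal aiming only needs a
symmetric form dominating the squared norm, and the Euclidean one does. -/
lemma sq_norm_le_augmentedInner {E : Type*} [NormedAddCommGroup E] [InnerProductSpace ℝ E]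
    (x : E × ℝ) : ‖x‖ ^ 2 ≤ augmentedInner E x x := by
  rw [augmentedInner_apply, real_inner_self_eq_norm_sq, ← sq, Prod.norm_def]
  rcases max_choice ‖x.1‖ ‖x.2‖ with h | h <;> rw [h]
  · linarith [sq_nonneg x.2]
  · rw [Real.norm_eq_abs, sq_abs]
    linarith [sq_nonneg ‖x.1‖]

end Augmented

theorem lemma4
    {n ma mb : ℕ}
    (A : Set (EuclideanSpace ℝ (Fin ma))) (B : Set (EuclideanSpace ℝ (Fin mb)))
    (f : EuclideanSpace ℝ (Fin n) → EuclideanSpace ℝ (Fin ma) → EuclideanSpace ℝ (Fin mb) →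
      EuclideanSpace ℝ (Fin n))
    (L : EuclideanSpace ℝ (Fin n) → EuclideanSpace ℝ (Fin ma) → EuclideanSpace ℝ (Fin mb) → ℝ)
    (g c : EuclideanSpace ℝ (Fin n) → ℝ)
    (hA : IsCompact A) (hB : IsCompact B) (hA₀ : A.Nonempty) (hB₀ : B.Nonempty)
    (hf_meas : ∀ x, Measurable (fun p : A × B => f x p.1 p.2))
    (hL_meas : ∀ x, Measurable (fun p : A × B => L x p.1 p.2))
    (hf_lip : ∃ K : ℝ≥0, ∀ a ∈ A, ∀ b ∈ B, LipschitzWith K (fun x => f x a b))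
    (hL_lip : ∃ K : ℝ≥0, ∀ a ∈ A, ∀ b ∈ B, LipschitzWith K (fun x => L x a b))
    (hf_im : ∀ x, IsCompact (Set.image2 (f x) A B) ∧ Convex ℝ (Set.image2 (f x) A B))
    (hL_im : ∀ x, IsCompact (Set.image2 (L x) A B) ∧ Convex ℝ (Set.image2 (L x) A B))
    (hg_lip : ∃ K : ℝ≥0, LipschitzWith K g)
    (hc_lip : ∃ K : ℝ≥0, LipschitzWith K c)
    (hL_bdd : ∃ m : ℝ, ∀ x, ∀ a ∈ A, ∀ b ∈ B, m ≤ L x a b)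
    (hg_bdd : ∃ m : ℝ, ∀ x, m ≤ g x)
    (T t : ℝ) (ht : t ∈ Set.Icc 0 T)
    (x : EuclideanSpace ℝ (Fin n)) (z : ℝ) :
    V2upper A B (fun _ => f) (fun _ => L) (fun _ => g) (fun _ => c) T t x z =
      (⨆ δ : PairStrategy A freezeSet B t T,
        ⨅ (α : ControlSignal A t T) (μ : ControlSignal freezeSet t T),
          costJtilde f L g c t T x z α.1 (δ.1 α μ).1 μ.1) ∧
    V2lower A B (fun _ => f) (fun _ => L) (fun _ => g) (fun _ => c) T t x z =
      (⨅ (γ : Strategy B A t T) (ν : Strategy B freezeSet t T),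
        ⨆ β : ControlSignal B t T,
          costJtilde f L g c t T x z (γ.1 β).1 β.1 (ν.1 β).1) := by
  obtain ⟨K, M, hF⟩ := exists_isGameField_augmentedField hA hB hA₀ hB₀ hf_meas hL_meas hf_lip hL_lip
    (hf_im 0).1 (hL_im 0).1
  obtain ⟨Kg, hKg⟩ := hg_lip
  obtain ⟨Kc, hKc⟩ := hc_lip
  have hc : LipschitzWith (Kc * 1) fun y : EuclideanSpace ℝ (Fin n) × ℝ => c y.1 :=
    hKc.comp LipschitzWith.prod_fst
  have hh : LipschitzWith (Kg * 1 + 1) fun y : EuclideanSpace ℝ (Fin n) × ℝ => g y.1 - y.2 :=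
    (hKg.comp LipschitzWith.prod_fst).sub LipschitzWith.prod_snd
  have htT : t ≤ T := ht.2
  simp only [V2upper, V2lower, costJ2_eq_iInf_stopCost hF hf_lip g c htT x z,
    costJtilde_eq_stopCost]
  constructor
  · exact le_antisymm (hF.iSup_strategy_le _ _ htT (x, z)) (hF.iSup_pairStrategy_le _ _ (x, z))
  · exact le_antisymm
      (hF.iInf_strategy_le hc hh htT (x, z) (augmentedInner _)
        (fun y w => by
          rw [augmentedInner_apply, augmentedInner_apply, real_inner_comm, mul_comm])
        sq_norm_le_augmentedInner)
      (hF.iInf_strategy_pair_le hh.continuous htT (x, z))
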